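/- Let $k$ be a natural number and let $X_1,X_2,\dots$ be independent random points of $\mathbb R^k$ with distributions $V'_1,V'_2,\dots$, whose distribution functions are continuous. Distributions are identified with their distribution functions $V(x)=V\{\xi:\xi_i\le x_i,\ i=1,\dots,k\}$. Put $$V_n=\frac1n\sum_{\nu=1}^n V'_\nu,\qquad S_n=\frac1n\sum_{\nu=1}^n\delta_{X_\nu},\qquad T_n=V_n-S_n .$$ Let $J$ be a convex set of probability distributions on $\mathbb R^k$ and $f:J\to\mathbb R$ a functional. Assume that for all sufficiently large $n$ one has $V_n\in J$ and, almost surely, $S_n\in J$. Assume: 1. $f$ is twice differentiable on $J$ in the sense of von Mises, with derivatives $f'\{V,Y\}$ and $f''\{V,Y,Z\}$: for all $V_1,V\in J$, the function $F(t)=f\{V_1+t(V-V_1)\}$, $0\le t\le1$, satisfies (with one-sided derivatives at $0$) $$F'(0)=\int f'\{V_1,Y\}\,d(V-V_1)(Y),\qquad F''(0)=\iint f''\{V_1,Y,Z\}\,d(V-V_1)(Y)\,d(V-V_1)(Z),$$ where $f'\{V_1,\cdot\}$ is integrable with respect to every $V\in J$ and $f''\{V_1,\cdot,\cdot\}$ with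 respect to every product $V\otimes W$, $V,W\in J$. 2. For $\nu\le n$ let $$a_\nu=\int f'\{V_n,Y\}\,dV'_\nu(Y),\qquad r_\nu^2=\int\big(f'\{V_n,Y\}-a_\nu\big)^2dV'_\nu(Y),\qquad s_n=\Big(\sum_{\nu=1}^n r_\nu^2\Big)^{1/2}.$$ (The quantities $a_\nu,r_\nu$ depend on $n$ as well.) The functions $f'\{V_n,\cdot\}$ satisfy one of the following conditions of the classical central limit theorem: - (Lindeberg) for all large $n$, $f'\{V_n,\cdot\}\in L^2(V'_\nu)$ for $\nu\le n$ and $s_n>0$, and for every $\delta>0$ $$\frac1{s_n^2}\sum_{\nu=1}^n\int_{|f'\{V_n,Y\}-a_\nu|>\delta s_n}\big(f'\{V_n,Y\}-a_\nu\big)^2dV'_\nu(Y)\to0 ;$$ - (Lyapunov type) for some $0<\varepsilon<1$, $s_n/n^{1/(2+\varepsilon)}\to\infty$ and the moments $C_\nu=\int|f'\{V_n,Y\}-a_\nu|^{2+\varepsilon}dV'_\nu(Y)$, $\nu\le n$, are bounded by a constant independent of $\nu$ and $n$, for all large $n$. 3. There is a measurable function $\psi\ge0$ on $\mathbb R^k$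 such that, for all large $n$, almost surely, for every $V\in J$, $$\Big|\iint f''\{V,Y,Z\}\,dT_n(Y)\,dT_n(Z)\Big|\le\int_{\mathbb R^k}\psi(x)\,T_n(x)^2\,dx\ (\le\infty),$$ and $$\lim_{n\to\infty}\frac1{s_n}\int_{\mathbb R^k}\psi(x)\,V_n(x)\,[1-V_n(x)]\,dx=0 .$$ For all large $n$ let $H_n>0$ be determined by $\dfrac1{2H_n^2}=\dfrac{s_n^2}{n^2}$. Then, for all large $n$, $$\frac{s_n^2}{n^2}=\frac1{n^2}\sum_{\nu=1}^n\Big[\int f'\{V_n,Y\}^2dV'_\nu(Y)-\Big(\int f'\{V_n,Y\}\,dV'_\nu(Y)\Big)^2\Big],$$ and, uniformly in $u\in\mathbb R$, $$\lim_{n\to\infty}P\big(H_n[f\{S_n\}-f\{V_n\}]\le u\big)=\Phi(u)=\frac1{\sqrt\pi}\int_{-\infty}^u e^{-t^2}dt .$$ -/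

import Mathlib

open MeasureTheory ProbabilityTheory Filter Topology Set
open scoped ENNReal

noncomputable section

/-- The distribution function of a distribution `V` on `ℝᵏ`: the `V`-probability that every
component `ξᵢ` satisfies `ξᵢ ≤ xᵢ` (`Set.Iic` refers to the componentwise order). -/
def distFun {k : ℕ} (V : Measure (Fin k → ℝ)) (x : Fin k → ℝ) : ℝ :=
  V.real (Set.Iic x)

/-- The empirical distribution ("répartition") of the first `n` of the points `x 0, x 1, …`. -/
def empiricalDist {k : ℕ} (x : ℕ → Fin k → ℝ) (n : ℕ) : Measure (Fin k → ℝ) :=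
  (n : ℝ≥0∞)⁻¹ • ∑ i ∈ Finset.range n, Measure.dirac (x i)

/-- The average of the first `n` of the distributions `V' 0, V' 1, …`. -/
def meanDist {k : ℕ} (V' : ℕ → Measure (Fin k → ℝ)) (n : ℕ) : Measure (Fin k → ℝ) :=
  (n : ℝ≥0∞)⁻¹ • ∑ i ∈ Finset.range n, V' i

/-- The distribution `V₁ + t (V - V₁)` (meaningful for `0 ≤ t ≤ 1`). -/
def segmentPoint {k : ℕ} (V₁ V : Measure (Fin k → ℝ)) (t : ℝ) : Measure (Fin k → ℝ) :=
  ENNReal.ofReal (1 - t) • V₁ + ENNReal.ofReal t • V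

/-- `J` is a convex set of probability distributions. -/
def IsConvexDistSet {k : ℕ} (J : Set (Measure (Fin k → ℝ))) : Prop :=
  (∀ V ∈ J, IsProbabilityMeasure V) ∧
    ∀ V₁ ∈ J, ∀ V ∈ J, ∀ t ∈ Set.Icc (0 : ℝ) 1, segmentPoint V₁ V t ∈ J

/-- `∫ g(Y) d(V - W)(Y)`. -/
def integralDiff {k : ℕ} (g : (Fin k → ℝ) → ℝ) (V W : Measure (Fin k → ℝ)) : ℝ :=
  ∫ y, g y ∂V - ∫ y, g y ∂W

/-- `∬ g(Y, Z) d(V - W)(Y) d(V - W)(Z)`. -/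
def integralDiff₂ {k : ℕ} (g : (Fin k → ℝ) → (Fin k → ℝ) → ℝ)
    (V W : Measure (Fin k → ℝ)) : ℝ :=
  ∫ p, g p.1 p.2 ∂(V.prod V) - ∫ p, g p.1 p.2 ∂(V.prod W)
    - ∫ p, g p.1 p.2 ∂(W.prod V) + ∫ p, g p.1 p.2 ∂(W.prod W)

/-- `g` is a (von Mises) derivative `f'{V₁, ·}` of the functional `f` (defined on `J`) at `V₁`:
for every `V ∈ J`, `d/dt f{V₁ + t (V - V₁)}` exists at `t = 0` and equals
`∫ g(Y) d(V - V₁)(Y)`, the integrals being absolutely convergent. The derivative at `0` is taken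
within `[0, 1]`, where the segment lies in `J`. -/
def HasVonMisesDerivAt {k : ℕ} (J : Set (Measure (Fin k → ℝ)))
    (f : Measure (Fin k → ℝ) → ℝ) (g : (Fin k → ℝ) → ℝ) (V₁ : Measure (Fin k → ℝ)) : Prop :=
  ∀ V ∈ J, Integrable g V ∧
    HasDerivWithinAt (fun t : ℝ => f (segmentPoint V₁ V t)) (integralDiff g V V₁)
      (Set.Icc 0 1) 0

/-- `h` is a second (von Mises) derivative `f''{V₁, ·, ·}` of `f` at `V₁`: for every `V ∈ J`,
`d²/dt² f{V₁ + t (V - V₁)}` exists at `t = 0` and equals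
`∬ h(Y, Z) d(V - V₁)(Y) d(V - V₁)(Z)`, the integrals being absolutely convergent. -/
def HasVonMisesSecondDerivAt {k : ℕ} (J : Set (Measure (Fin k → ℝ)))
    (f : Measure (Fin k → ℝ) → ℝ) (h : (Fin k → ℝ) → (Fin k → ℝ) → ℝ)
    (V₁ : Measure (Fin k → ℝ)) : Prop :=
  (∀ V ∈ J, ∀ W ∈ J, Integrable (fun p : (Fin k → ℝ) × (Fin k → ℝ) => h p.1 p.2) (V.prod W)) ∧
  ∀ V ∈ J,
    HasDerivWithinAt
      (fun t : ℝ => derivWithin (fun s : ℝ => f (segmentPoint V₁ V s)) (Set.Icc 0 1) t)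
      (integralDiff₂ h V V₁) (Set.Icc 0 1) 0

/-- `f` is twice differentiable at every point of `J`, with first derivative `f₁ V Y = f'{V, Y}`
and second derivative `f₂ V Y Z = f''{V, Y, Z}`. -/
def IsTwiceVonMisesDiffOn {k : ℕ} (J : Set (Measure (Fin k → ℝ)))
    (f : Measure (Fin k → ℝ) → ℝ) (f₁ : Measure (Fin k → ℝ) → (Fin k → ℝ) → ℝ)
    (f₂ : Measure (Fin k → ℝ) → (Fin k → ℝ) → (Fin k → ℝ) → ℝ) : Prop :=
  ∀ V ∈ J, HasVonMisesDerivAt J f (f₁ V) V ∧ HasVonMisesSecondDerivAt J f (f₂ V) V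

section rows

variable {k : ℕ} (f₁ : Measure (Fin k → ℝ) → (Fin k → ℝ) → ℝ)
  (V' : ℕ → Measure (Fin k → ℝ))

/-- `a_ν = ∫ f'{Vₙ, Y} dV'_ν(Y)`. -/
def rowMean (n ν : ℕ) : ℝ := ∫ y, f₁ (meanDist V' n) y ∂(V' ν)

/-- `r_ν² = ∫ (f'{Vₙ, Y} - a_ν)² dV'_ν(Y)`. -/
def rowVar (n ν : ℕ) : ℝ := ∫ y, (f₁ (meanDist V' n) y - rowMean f₁ V' n ν) ^ 2 ∂(V' ν)

/-- `sₙ`, the nonnegative root of `sₙ² = ∑ r_ν²`, the sum being over the first `n` indices. -/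
def rowStd (n : ℕ) : ℝ := Real.sqrt (∑ ν ∈ Finset.range n, rowVar f₁ V' n ν)

/-- Lindeberg's condition for the rows `f'{Vₙ, X_ν}`, `ν` among the first `n` indices. -/
def LindebergCondition : Prop :=
  (∀ᶠ n in atTop, ∀ ν < n, MemLp (f₁ (meanDist V' n)) 2 (V' ν)) ∧
  (∀ᶠ n in atTop, 0 < rowStd f₁ V' n) ∧
  ∀ δ : ℝ, 0 < δ →
    Tendsto (fun n => (∑ ν ∈ Finset.range n,
        ∫ y in {y | δ * rowStd f₁ V' n < |f₁ (meanDist V' n) y - rowMean f₁ V' n ν|},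
          (f₁ (meanDist V' n) y - rowMean f₁ V' n ν) ^ 2 ∂(V' ν)) / (rowStd f₁ V' n) ^ 2)
      atTop (𝓝 0)

/-- The Lyapunov-type condition with exponent `2 + ε`: the absolute central moments of order
`2 + ε` of `f'{Vₙ, X_ν}` are bounded uniformly in `n` and `ν`, and `sₙ / n^(1/(2+ε)) → ∞`. -/
def LyapunovCondition (ε : ℝ) : Prop :=
  (∃ C : ℝ, ∀ᶠ n in atTop, ∀ ν < n,
    Integrable (fun y => |f₁ (meanDist V' n) y - rowMean f₁ V' n ν| ^ (2 + ε)) (V' ν) ∧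
    ∫ y, |f₁ (meanDist V' n) y - rowMean f₁ V' n ν| ^ (2 + ε) ∂(V' ν) ≤ C) ∧
  Tendsto (fun n : ℕ => rowStd f₁ V' n / (n : ℝ) ^ (1 / (2 + ε))) atTop atTop

end rows

/-- The Gauss function `Φ(u) = π^(-1/2) ∫_{-∞}^u exp(-t²) dt`. -/
def gaussPhi (u : ℝ) : ℝ := 1 / Real.sqrt Real.pi * ∫ t in Set.Iic u, Real.exp (-t ^ 2)

end

/-! Von Mises' method: expand `f` at `Vₙ` in the direction `Sₙ - Vₙ`, show that the linear term is
asymptotically normal and that the quadratic one is negligible.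

Differentiability is assumed only at the starting point of each segment. Since `J` is convex, every
point of a segment starts subsegments towards both endpoints, so the derivatives exist along the
whole segment (`IsTwiceVonMisesDiffOn.hasDerivWithinAt`,
`IsTwiceVonMisesDiffOn.hasDerivWithinAt_integralDiff`). Taylor's inequality then bounds the error of
the linear approximation by half of a bound of `f''{V}` on `(Tₙ, Tₙ)` uniform in `V ∈ J`, that is,
by `½ ∫ ψ Tₙ²`.

The linear term is `n⁻¹ ∑ (f'{Vₙ, X_ν} - a_ν)`, a sum of independent centred variables. Multiplied
by `Hₙ = n / (√2 sₙ)` it has variance 1/2, and Lindeberg's theorem, proved here by characteristic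
functions, gives the limit `Φ`; the Lyapunov-type condition implies Lindeberg's.

For the remainder, `E Tₙ(x)² ≤ n⁻¹ Vₙ(x) (1 - Vₙ(x))`. By Tonelli the mean of `½ Hₙ ∫ ψ Tₙ²` is at
most `(2√2 sₙ)⁻¹ ∫ ψ Vₙ (1 - Vₙ)`, which tends to 0, and Markov's inequality gives convergence to 0
in probability. Slutsky's theorem combines the two parts, and Pólya's theorem makes the convergence
uniform because `Φ` is continuous. -/

section Segments

/-! ### Segments of distributions and their reparametrization from an intermediate point -/

variable {k : ℕ}

lemma segmentPoint_zero (V₁ V : Measure (Fin k → ℝ)) : segmentPoint V₁ V 0 = V₁ := by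
  simp [segmentPoint]

lemma segmentPoint_one (V₁ V : Measure (Fin k → ℝ)) : segmentPoint V₁ V 1 = V := by
  simp [segmentPoint]

lemma segmentPoint_segmentPoint_right (V₁ V : Measure (Fin k → ℝ)) {s t : ℝ}
    (hs : s ∈ Icc (0 : ℝ) 1) (ht : t ∈ Icc (0 : ℝ) 1) :
    segmentPoint (segmentPoint V₁ V t) V s = segmentPoint V₁ V (t + s * (1 - t)) := by
  have h1 : 0 ≤ 1 - s := by linarith [hs.2]
  have h2 : 0 ≤ 1 - t := by linarith [ht.2]
  simp only [segmentPoint, smul_add, smul_smul, ← ENNReal.ofReal_mul h1, add_assoc, ← add_smul]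
  rw [← ENNReal.ofReal_add (mul_nonneg h1 ht.1) hs.1]
  congr 3 <;> ring

lemma segmentPoint_segmentPoint_left (V₁ V : Measure (Fin k → ℝ)) {s t : ℝ}
    (hs : s ∈ Icc (0 : ℝ) 1) (ht : t ∈ Icc (0 : ℝ) 1) :
    segmentPoint (segmentPoint V₁ V t) V₁ s = segmentPoint V₁ V (t - s * t) := by
  have h1 : 0 ≤ 1 - s := by linarith [hs.2]
  have h2 : 0 ≤ 1 - t := by linarith [ht.2]
  simp only [segmentPoint, smul_add, smul_smul, ← ENNReal.ofReal_mul h1]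
  rw [add_right_comm, ← add_smul, ← ENNReal.ofReal_add (mul_nonneg h1 h2) hs.1]
  congr 3 <;> ring

lemma integral_segmentPoint {g : (Fin k → ℝ) → ℝ} {V₁ V : Measure (Fin k → ℝ)} {t : ℝ}
    (ht : t ∈ Icc (0 : ℝ) 1) (h₁ : Integrable g V₁) (h : Integrable g V) :
    ∫ y, g y ∂(segmentPoint V₁ V t) = (1 - t) * ∫ y, g y ∂V₁ + t * ∫ y, g y ∂V := by
  rw [segmentPoint, integral_add_measure (h₁.smul_measure ENNReal.ofReal_ne_top)
    (h.smul_measure ENNReal.ofReal_ne_top), integral_smul_measure, integral_smul_measure,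
    ENNReal.toReal_ofReal (by linarith [ht.2]), ENNReal.toReal_ofReal ht.1, smul_eq_mul,
    smul_eq_mul]

/-- For `W = V₁ + t (V - V₁)` one has `V - W = (1 - t) (V - V₁)` and `V₁ - W = -t (V - V₁)`. The
linear form therefore scales by `1 - t` and `-t`, and the quadratic form below by the squares of
these factors. -/
lemma integralDiff_segmentPoint_right {g : (Fin k → ℝ) → ℝ} {V₁ V : Measure (Fin k → ℝ)} {t : ℝ}
    (ht : t ∈ Icc (0 : ℝ) 1) (h₁ : Integrable g V₁) (h : Integrable g V) :
    integralDiff g V (segmentPoint V₁ V t) = (1 - t) * integralDiff g V V₁ := by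
  rw [integralDiff, integral_segmentPoint ht h₁ h, integralDiff]
  ring

lemma integralDiff_segmentPoint_left {g : (Fin k → ℝ) → ℝ} {V₁ V : Measure (Fin k → ℝ)} {t : ℝ}
    (ht : t ∈ Icc (0 : ℝ) 1) (h₁ : Integrable g V₁) (h : Integrable g V) :
    integralDiff g V₁ (segmentPoint V₁ V t) = -t * integralDiff g V V₁ := by
  rw [integralDiff, integral_segmentPoint ht h₁ h, integralDiff]
  ring

section Prod

variable {α : Type*} [MeasurableSpace α]

lemma integral_prod_smul_add_smul {g : α × α → ℝ} {A B W : Measure α} [SFinite A] [SFinite B]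
    [SFinite W] {a b : ℝ} (ha : 0 ≤ a) (hb : 0 ≤ b)
    (h₁ : Integrable g (W.prod A)) (h₂ : Integrable g (W.prod B)) :
    ∫ p, g p ∂(W.prod (ENNReal.ofReal a • A + ENNReal.ofReal b • B)) =
      a * ∫ p, g p ∂(W.prod A) + b * ∫ p, g p ∂(W.prod B) := by
  rw [Measure.prod_add, Measure.prod_smul_right, Measure.prod_smul_right,
    integral_add_measure (h₁.smul_measure ENNReal.ofReal_ne_top)
    (h₂.smul_measure ENNReal.ofReal_ne_top), integral_smul_measure, integral_smul_measure,
    ENNReal.toReal_ofReal ha, ENNReal.toReal_ofReal hb, smul_eq_mul, smul_eq_mul]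

lemma integral_smul_add_smul_prod {g : α × α → ℝ} {A B W : Measure α} [SFinite A] [SFinite B]
    [SFinite W] {a b : ℝ} (ha : 0 ≤ a) (hb : 0 ≤ b)
    (h₁ : Integrable g (A.prod W)) (h₂ : Integrable g (B.prod W)) :
    ∫ p, g p ∂((ENNReal.ofReal a • A + ENNReal.ofReal b • B).prod W) =
      a * ∫ p, g p ∂(A.prod W) + b * ∫ p, g p ∂(B.prod W) := by
  rw [Measure.add_prod, Measure.prod_smul_left, Measure.prod_smul_left,
    integral_add_measure (h₁.smul_measure ENNReal.ofReal_ne_top)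
    (h₂.smul_measure ENNReal.ofReal_ne_top), integral_smul_measure, integral_smul_measure,
    ENNReal.toReal_ofReal ha, ENNReal.toReal_ofReal hb, smul_eq_mul, smul_eq_mul]

end Prod

/-- The bilinear form `h` is integrable with respect to all products of the elements of `J`. -/
def IntegrableOnProducts (J : Set (Measure (Fin k → ℝ)))
    (h : (Fin k → ℝ) → (Fin k → ℝ) → ℝ) : Prop :=
  ∀ V ∈ J, ∀ W ∈ J, Integrable (fun p : (Fin k → ℝ) × (Fin k → ℝ) => h p.1 p.2) (V.prod W)

lemma integralDiff₂_segmentPoint_right {J : Set (Measure (Fin k → ℝ))} (hJ : IsConvexDistSet J)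
    {h : (Fin k → ℝ) → (Fin k → ℝ) → ℝ} (hh : IntegrableOnProducts J h)
    {V₁ V : Measure (Fin k → ℝ)} (hV₁ : V₁ ∈ J) (hV : V ∈ J) {t : ℝ} (ht : t ∈ Icc (0 : ℝ) 1) :
    integralDiff₂ h V (segmentPoint V₁ V t) = (1 - t) ^ 2 * integralDiff₂ h V V₁ := by
  have := hJ.1 V hV
  have := hJ.1 V₁ hV₁
  have hW := hJ.2 V₁ hV₁ V hV t ht
  have := hJ.1 _ hW
  have h0 : 0 ≤ 1 - t := by linarith [ht.2]
  have e₁ := integral_prod_smul_add_smul h0 ht.1 (hh V hV V₁ hV₁) (hh V hV V hV)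
  have e₂ := integral_smul_add_smul_prod h0 ht.1 (hh V₁ hV₁ V hV) (hh V hV V hV)
  have e₃ := integral_prod_smul_add_smul h0 ht.1 (hh _ hW V₁ hV₁) (hh _ hW V hV)
  have e₄ := integral_smul_add_smul_prod h0 ht.1 (hh V₁ hV₁ V₁ hV₁) (hh V hV V₁ hV₁)
  simp only [integralDiff₂, segmentPoint] at e₃ ⊢
  rw [e₁, e₂, e₃, e₄, e₂]
  ring

lemma integralDiff₂_segmentPoint_left {J : Set (Measure (Fin k → ℝ))} (hJ : IsConvexDistSet J)
    {h : (Fin k → ℝ) → (Fin k → ℝ) → ℝ} (hh : IntegrableOnProducts J h)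
    {V₁ V : Measure (Fin k → ℝ)} (hV₁ : V₁ ∈ J) (hV : V ∈ J) {t : ℝ} (ht : t ∈ Icc (0 : ℝ) 1) :
    integralDiff₂ h V₁ (segmentPoint V₁ V t) = t ^ 2 * integralDiff₂ h V V₁ := by
  have := hJ.1 V hV
  have := hJ.1 V₁ hV₁
  have hW := hJ.2 V₁ hV₁ V hV t ht
  have := hJ.1 _ hW
  have h0 : 0 ≤ 1 - t := by linarith [ht.2]
  have e₁ := integral_prod_smul_add_smul h0 ht.1 (hh V₁ hV₁ V₁ hV₁) (hh V₁ hV₁ V hV)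
  have e₂ := integral_smul_add_smul_prod h0 ht.1 (hh V₁ hV₁ V hV) (hh V hV V hV)
  have e₃ := integral_prod_smul_add_smul h0 ht.1 (hh _ hW V₁ hV₁) (hh _ hW V hV)
  have e₄ := integral_smul_add_smul_prod h0 ht.1 (hh V₁ hV₁ V₁ hV₁) (hh V hV V₁ hV₁)
  simp only [integralDiff₂, segmentPoint] at e₃ ⊢
  rw [e₁, e₃, e₄, e₂]
  ring

end Segments

/-! ### Differentiation along a whole segment and von Mises' expansion -/

section Taylor

/-- A function on `[0, 1]` is differentiable at `t` if it is so along the two affine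
parametrizations of `[t, 1]` and `[0, t]` that start at `t`. -/
lemma hasDerivWithinAt_Icc_of_affine {φ : ℝ → ℝ} {t c : ℝ} (ht : t ∈ Icc (0 : ℝ) 1)
    (hr : HasDerivWithinAt (fun s => φ (t + s * (1 - t))) ((1 - t) * c) (Icc 0 1) 0)
    (hl : HasDerivWithinAt (fun s => φ (t - s * t)) (-t * c) (Icc 0 1) 0) :
    HasDerivWithinAt φ c (Icc 0 1) t := by
  rw [← Icc_union_Icc_eq_Icc ht.1 ht.2]
  refine HasDerivWithinAt.union ?_ ?_
  · rcases ht.1.eq_or_lt with rfl | h0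
    -- At `t = 0` the left piece is a single point, where any number is a derivative.
    · simp [hasDerivWithinAt_iff_hasFDerivWithinAt, HasFDerivWithinAt.singleton]
    have hg : HasDerivWithinAt (fun u => (t - u) / t) (-1 / t) (Icc 0 t) t :=
      ((hasDerivAt_id t).const_sub t |>.div_const t).hasDerivWithinAt
    have hmaps : MapsTo (fun u => (t - u) / t) (Icc 0 t) (Icc 0 1) := by
      intro u hu
      exact ⟨div_nonneg (by linarith [hu.2]) h0.le, (div_le_one h0).2 (by linarith [hu.1])⟩
    have := HasDerivWithinAt.scomp_of_eq t hl hg hmaps (by simp)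
    refine (this.congr (fun u _ => ?_) ?_).congr_deriv ?_
    · simp only [Function.comp]; congr 1; field_simp; ring
    · simp
    · rw [smul_eq_mul]; field_simp
  · rcases ht.2.eq_or_lt with rfl | h1
    · simp [hasDerivWithinAt_iff_hasFDerivWithinAt, HasFDerivWithinAt.singleton]
    have h1' : 0 < 1 - t := by linarith
    have hg : HasDerivWithinAt (fun u => (u - t) / (1 - t)) (1 / (1 - t)) (Icc t 1) t :=
      ((hasDerivAt_id t).sub_const t |>.div_const (1 - t)).hasDerivWithinAt
    have hmaps : MapsTo (fun u => (u - t) / (1 - t)) (Icc t 1) (Icc 0 1) := by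
      intro u hu
      exact ⟨div_nonneg (by linarith [hu.1]) h1'.le, (div_le_one h1').2 (by linarith [hu.2])⟩
    have := HasDerivWithinAt.scomp_of_eq t hr hg hmaps (by simp)
    refine (this.congr (fun u _ => ?_) ?_).congr_deriv ?_
    · simp only [Function.comp]; congr 1; field_simp; ring
    · simp
    · rw [smul_eq_mul]; field_simp

/-- Taylor's inequality of order two on `[0, 1]`. -/
lemma abs_sub_sub_deriv_le {F D E : ℝ → ℝ} {M : ℝ}
    (hF : ∀ t ∈ Icc (0 : ℝ) 1, HasDerivWithinAt F (D t) (Icc 0 1) t)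
    (hD : ∀ t ∈ Icc (0 : ℝ) 1, HasDerivWithinAt D (E t) (Icc 0 1) t)
    (hE : ∀ t ∈ Icc (0 : ℝ) 1, |E t| ≤ M) :
    |F 1 - F 0 - D 0| ≤ M / 2 := by
  have hbd : ∀ t ∈ Icc (0 : ℝ) 1, ‖D t - D 0‖ ≤ M * (t - 0) :=
    norm_image_sub_le_of_norm_deriv_le_segment' hD fun t ht => hE t ⟨ht.1, ht.2.le⟩
  have hK : ∀ t ∈ Icc (0 : ℝ) 1,
      HasDerivWithinAt (fun t => F t - F 0 - D 0 * t) (D t - D 0) (Icc 0 1) t := fun t ht => by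
    have := ((hF t ht).sub_const (F 0)).sub ((hasDerivWithinAt_id t _).const_mul (D 0))
    rwa [mul_one] at this
  -- The bound `M t` just found is the derivative of `M t² / 2`, so a second comparison yields the
  -- sharp factor 1/2.
  have := image_norm_le_of_norm_deriv_right_le_deriv_boundary (a := 0) (b := 1)
    (f := fun t => F t - F 0 - D 0 * t) (f' := fun t => D t - D 0) (B := fun t => M * t ^ 2 / 2)
    (B' := fun t => M * t) (fun t ht => (hK t ht).continuousWithinAt)
    (fun t ht => (hK t ⟨ht.1, ht.2.le⟩).mono_of_mem_nhdsWithin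
      (mem_of_superset (Icc_mem_nhdsGE ht.2) (Icc_subset_Icc_left ht.1)))
    (by simp)
    (fun t => by
      have := (((hasDerivAt_id t).pow 2).const_mul M).div_const 2
      refine this.congr_deriv ?_
      simp; ring)
    (fun t ht => by simpa using hbd t ⟨ht.1, ht.2.le⟩) (right_mem_Icc.2 zero_le_one)
  simpa using this

variable {k : ℕ} {J : Set (Measure (Fin k → ℝ))} {f : Measure (Fin k → ℝ) → ℝ}
  {f₁ : Measure (Fin k → ℝ) → (Fin k → ℝ) → ℝ}
  {f₂ : Measure (Fin k → ℝ) → (Fin k → ℝ) → (Fin k → ℝ) → ℝ}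

/-- The point at parameter `t` lies in `J` by convexity, so the hypothesis applies there in the
directions of both endpoints; the two one-sided derivatives agree after rescaling. -/
lemma IsTwiceVonMisesDiffOn.hasDerivWithinAt (hf : IsTwiceVonMisesDiffOn J f f₁ f₂)
    (hJ : IsConvexDistSet J) {V₁ V : Measure (Fin k → ℝ)} (hV₁ : V₁ ∈ J) (hV : V ∈ J) {t : ℝ}
    (ht : t ∈ Icc (0 : ℝ) 1) :
    HasDerivWithinAt (fun t => f (segmentPoint V₁ V t))
      (integralDiff (f₁ (segmentPoint V₁ V t)) V V₁) (Icc 0 1) t := by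
  have hW := hJ.2 V₁ hV₁ V hV t ht
  obtain ⟨i₁, d₁⟩ := (hf _ hW).1 V₁ hV₁
  obtain ⟨i, d⟩ := (hf _ hW).1 V hV
  refine hasDerivWithinAt_Icc_of_affine ht ?_ ?_
  · rw [integralDiff_segmentPoint_right ht i₁ i] at d
    exact d.congr_of_mem (fun s hs => by rw [segmentPoint_segmentPoint_right V₁ V hs ht])
      (left_mem_Icc.2 zero_le_one)
  · rw [integralDiff_segmentPoint_left ht i₁ i] at d₁
    exact d₁.congr_of_mem (fun s hs => by rw [segmentPoint_segmentPoint_left V₁ V hs ht])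
      (left_mem_Icc.2 zero_le_one)

/-- The same gluing, one order higher. By the previous lemma the first derivative along the rebased
segment is `1 - t` (or `-t`) times the function considered here, while the second derivative carries
the square of that factor; one division leaves the factor required for gluing. -/
lemma IsTwiceVonMisesDiffOn.hasDerivWithinAt_integralDiff (hf : IsTwiceVonMisesDiffOn J f f₁ f₂)
    (hJ : IsConvexDistSet J) {V₁ V : Measure (Fin k → ℝ)} (hV₁ : V₁ ∈ J) (hV : V ∈ J) {t : ℝ}
    (ht : t ∈ Icc (0 : ℝ) 1) :
    HasDerivWithinAt (fun t => integralDiff (f₁ (segmentPoint V₁ V t)) V V₁)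
      (integralDiff₂ (f₂ (segmentPoint V₁ V t)) V V₁) (Icc 0 1) t := by
  have hW := hJ.2 V₁ hV₁ V hV t ht
  have hh : IntegrableOnProducts J (f₂ (segmentPoint V₁ V t)) := (hf _ hW).2.1
  have d₁ := (hf _ hW).2.2 V₁ hV₁
  have d := (hf _ hW).2.2 V hV
  have hmem : (0 : ℝ) ∈ Icc (0 : ℝ) 1 := left_mem_Icc.2 zero_le_one
  have huniq : ∀ s ∈ Icc (0 : ℝ) 1, UniqueDiffWithinAt ℝ (Icc (0 : ℝ) 1) s :=
    uniqueDiffOn_Icc zero_lt_one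
  refine hasDerivWithinAt_Icc_of_affine ht ?_ ?_
  · rcases ht.2.eq_or_lt with rfl | h1
    -- At `t = 1` the rebased segment is a point; no division by `1 - t` is possible or needed.
    · simpa using hasDerivWithinAt_const _ _ _
    have h1' : 1 - t ≠ 0 := by linarith
    rw [integralDiff₂_segmentPoint_right hJ hh hV₁ hV ht] at d
    refine ((d.const_mul (1 - t)⁻¹).congr_of_mem (fun s hs => ?_) hmem).congr_deriv
      (by field_simp)
    have hm : t + s * (1 - t) ∈ Icc (0 : ℝ) 1 :=
      ⟨add_nonneg ht.1 (mul_nonneg hs.1 (by linarith)), by nlinarith [hs.2]⟩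
    have hU := hJ.2 V₁ hV₁ V hV _ hm
    rw [(hf.hasDerivWithinAt hJ hW hV hs).derivWithin (huniq s hs),
      segmentPoint_segmentPoint_right V₁ V hs ht,
      integralDiff_segmentPoint_right ht ((hf _ hU).1 V₁ hV₁).1 ((hf _ hU).1 V hV).1]
    field_simp
  · rcases ht.1.eq_or_lt with rfl | h0
    · simpa using hasDerivWithinAt_const _ _ _
    rw [integralDiff₂_segmentPoint_left hJ hh hV₁ hV ht] at d₁
    refine ((d₁.const_mul (-t)⁻¹).congr_of_mem (fun s hs => ?_) hmem).congr_deriv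
      (by field_simp)
    have hm : t - s * t ∈ Icc (0 : ℝ) 1 := ⟨by nlinarith [hs.2], by nlinarith [hs.1, ht.2]⟩
    have hU := hJ.2 V₁ hV₁ V hV _ hm
    rw [(hf.hasDerivWithinAt hJ hW hV₁ hs).derivWithin (huniq s hs),
      segmentPoint_segmentPoint_left V₁ V hs ht,
      integralDiff_segmentPoint_left ht ((hf _ hU).1 V₁ hV₁).1 ((hf _ hU).1 V hV).1]
    field_simp

/-- Von Mises' expansion: the error of the linear approximation of `f` is at most one half of a
bound of the second derivative. -/
lemma IsTwiceVonMisesDiffOn.abs_sub_sub_integralDiff_le (hf : IsTwiceVonMisesDiffOn J f f₁ f₂)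
    (hJ : IsConvexDistSet J) {V₁ V : Measure (Fin k → ℝ)} (hV₁ : V₁ ∈ J) (hV : V ∈ J) {M : ℝ}
    (hM : ∀ W ∈ J, |integralDiff₂ (f₂ W) V₁ V| ≤ M) :
    |f V - f V₁ - integralDiff (f₁ V₁) V V₁| ≤ M / 2 := by
  have := abs_sub_sub_deriv_le (fun t ht => hf.hasDerivWithinAt hJ hV₁ hV ht)
    (fun t ht => hf.hasDerivWithinAt_integralDiff hJ hV₁ hV ht) (M := M) (fun t ht => by
      have := hM _ (hJ.2 V₁ hV₁ V hV t ht)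
      -- The quadratic form is even, so `V₁ - V` may replace `V - V₁`.
      convert this using 2
      simp only [integralDiff₂]
      ring)
  simpa only [segmentPoint_zero, segmentPoint_one] using this

end Taylor

/-! ### Lindeberg's central limit theorem for triangular arrays -/

section Lindeberg

/-- Telescoping: the factors are exchanged one at a time, the others having modulus at most 1. -/
lemma norm_prod_sub_prod_le_sum {ι : Type*} (s : Finset ι) {a b : ι → ℂ}
    (ha : ∀ i ∈ s, ‖a i‖ ≤ 1) (hb : ∀ i ∈ s, ‖b i‖ ≤ 1) :
    ‖∏ i ∈ s, a i - ∏ i ∈ s, b i‖ ≤ ∑ i ∈ s, ‖a i - b i‖ := by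
  classical
  induction s using Finset.induction_on with
  | empty => simp
  | insert j s hj ih =>
    have ha' : ∀ i ∈ s, ‖a i‖ ≤ 1 := fun i hi => ha i (Finset.mem_insert_of_mem hi)
    have hb' : ∀ i ∈ s, ‖b i‖ ≤ 1 := fun i hi => hb i (Finset.mem_insert_of_mem hi)
    rw [Finset.prod_insert hj, Finset.prod_insert hj, Finset.sum_insert hj]
    have hA : ‖∏ i ∈ s, a i‖ ≤ 1 := by
      rw [norm_prod]
      exact Finset.prod_le_one (fun _ _ => norm_nonneg _) ha'
    calc ‖a j * ∏ i ∈ s, a i - b j * ∏ i ∈ s, b i‖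
        = ‖(a j - b j) * ∏ i ∈ s, a i + b j * (∏ i ∈ s, a i - ∏ i ∈ s, b i)‖ := by ring_nf
      _ ≤ ‖a j - b j‖ * ‖∏ i ∈ s, a i‖ + ‖b j‖ * ‖∏ i ∈ s, a i - ∏ i ∈ s, b i‖ := by
        refine (norm_add_le _ _).trans ?_
        rw [norm_mul, norm_mul]
      _ ≤ ‖a j - b j‖ * 1 + 1 * ∑ i ∈ s, ‖a i - b i‖ := by
        gcongr
        · exact hb j (Finset.mem_insert_self j s)
        · exact ih ha' hb'
      _ = _ := by ring

lemma norm_exp_mul_I_sub_le_cube {y : ℝ} (hy : |y| ≤ 1) :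
    ‖Complex.exp (y * Complex.I) - (1 + y * Complex.I - y ^ 2 / 2)‖ ≤ |y| ^ 3 := by
  have hn : ‖(y * Complex.I : ℂ)‖ = |y| := by simp
  have := Complex.exp_bound (x := y * Complex.I) (by rwa [hn]) (n := 3) (by norm_num)
  rw [hn] at this
  have e : ∑ m ∈ Finset.range 3, (y * Complex.I : ℂ) ^ m / m.factorial =
      1 + y * Complex.I - y ^ 2 / 2 := by
    simp [Finset.sum_range_succ, mul_pow, Nat.factorial]
    ring
  rw [e] at this
  refine this.trans ?_
  have h3 : 0 ≤ |y| ^ 3 := by positivity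
  norm_num [Nat.factorial]
  linarith

lemma norm_exp_mul_I_sub_le_of_one_le {y : ℝ} (hy : 1 ≤ |y|) :
    ‖Complex.exp (y * Complex.I) - (1 + y * Complex.I - y ^ 2 / 2)‖ ≤ 4 * y ^ 2 := by
  have h1 : |y| ≤ y ^ 2 := by rw [← sq_abs]; nlinarith
  calc ‖Complex.exp (y * Complex.I) - (1 + y * Complex.I - y ^ 2 / 2)‖
      ≤ ‖Complex.exp (y * Complex.I)‖ + (‖(1 : ℂ)‖ + ‖(y * Complex.I : ℂ)‖ + ‖(y ^ 2 / 2 : ℂ)‖) :=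
        (norm_sub_le _ _).trans (by gcongr; exact (norm_sub_le _ _).trans (by
          gcongr; exact norm_add_le _ _))
    _ = 1 + (1 + |y| + y ^ 2 / 2) := by
        rw [Complex.norm_exp_ofReal_mul_I]
        simp
    _ ≤ 4 * y ^ 2 := by linarith

lemma norm_exp_mul_I_sub_le_sq (y : ℝ) :
    ‖Complex.exp (y * Complex.I) - (1 + y * Complex.I - y ^ 2 / 2)‖ ≤ 4 * y ^ 2 := by
  rcases le_total |y| 1 with hy | hy
  · refine (norm_exp_mul_I_sub_le_cube hy).trans ?_
    rw [← sq_abs]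
    nlinarith [abs_nonneg y, sq_nonneg |y|]
  · exact norm_exp_mul_I_sub_le_of_one_le hy

lemma norm_exp_mul_I_sub_le_mul_cube (y : ℝ) :
    ‖Complex.exp (y * Complex.I) - (1 + y * Complex.I - y ^ 2 / 2)‖ ≤ 4 * |y| ^ 3 := by
  rcases le_total |y| 1 with hy | hy
  · exact (norm_exp_mul_I_sub_le_cube hy).trans (by nlinarith [pow_nonneg (abs_nonneg y) 3])
  · refine (norm_exp_mul_I_sub_le_of_one_le hy).trans ?_
    rw [← sq_abs]
    nlinarith [abs_nonneg y, sq_nonneg |y|]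

lemma abs_exp_neg_sub_one_sub_le {x : ℝ} (hx : 0 ≤ x) : |Real.exp (-x) - (1 - x)| ≤ x ^ 2 := by
  rcases le_total x 1 with h | h
  · have := Real.abs_exp_sub_one_sub_id_le (x := -x) (by rwa [abs_neg, abs_of_nonneg hx])
    rw [neg_sq] at this
    convert this using 2
    ring
  · have h1 := Real.exp_pos (-x)
    have h2 : Real.exp (-x) ≤ 1 := Real.exp_le_one_iff.2 (by linarith)
    rw [abs_of_nonneg (by linarith)]
    nlinarith

variable {Ω : Type*} [MeasurableSpace Ω] {P : Measure Ω} [IsProbabilityMeasure P]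

/-- The Taylor error of `exp (itY)` is bounded quadratically where `|Y| > δ` and cubically
elsewhere, where `|Y|³ ≤ δ Y²`. The linear term vanishes because `Y` is centred. -/
lemma norm_charFun_map_sub_le {Y : Ω → ℝ} (mY : Measurable Y) (h2 : MemLp Y 2 P)
    (h0 : ∫ ω, Y ω ∂P = 0) {δ : ℝ} (hδ : 0 ≤ δ) (t : ℝ) :
    ‖charFun (P.map Y) t - (1 - t ^ 2 / 2 * ∫ ω, Y ω ^ 2 ∂P : ℝ)‖ ≤
      4 * t ^ 2 * ∫ ω in {ω | δ < |Y ω|}, Y ω ^ 2 ∂P + 4 * |t| ^ 3 * δ * ∫ ω, Y ω ^ 2 ∂P := by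
  have i1 : Integrable Y P := h2.integrable (by norm_num)
  have i2 : Integrable (fun ω => Y ω ^ 2) P := h2.integrable_sq
  have ie : Integrable (fun ω => Complex.exp ((t * Y ω : ℝ) * Complex.I)) P := by
    refine Integrable.of_bound (C := 1) (by fun_prop) ?_
    exact ae_of_all _ fun ω => (Complex.norm_exp_ofReal_mul_I _).le
  have i1c : Integrable (fun ω => ((t * Y ω : ℝ) : ℂ) * Complex.I) P :=
    ((i1.const_mul t).ofReal).mul_const _
  have i2c : Integrable (fun ω => ((t * Y ω : ℝ) : ℂ) ^ 2 / 2) P := by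
    have := ((i2.const_mul (t ^ 2 / 2)).ofReal (𝕜 := ℂ))
    refine this.congr (ae_of_all _ fun ω => ?_)
    change ((t ^ 2 / 2 * Y ω ^ 2 : ℝ) : ℂ) = _
    push_cast
    ring
  have i12 : Integrable (fun ω => (1 + (t * Y ω : ℝ) * Complex.I : ℂ)) P :=
    (integrable_const _).add i1c
  have i3 : Integrable (fun ω => (1 + (t * Y ω : ℝ) * Complex.I - (t * Y ω : ℝ) ^ 2 / 2 : ℂ)) P :=
    i12.sub i2c
  have ms : MeasurableSet {ω | δ < |Y ω|} := measurableSet_lt measurable_const (by fun_prop)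
  have e1 : charFun (P.map Y) t = ∫ ω, Complex.exp ((t * Y ω : ℝ) * Complex.I) ∂P := by
    rw [charFun_apply_real, integral_map mY.aemeasurable (by fun_prop)]
    simp
  have e2 : charFun (P.map Y) t - (1 - t ^ 2 / 2 * ∫ ω, Y ω ^ 2 ∂P : ℝ) =
      ∫ ω, (Complex.exp ((t * Y ω : ℝ) * Complex.I) -
        (1 + (t * Y ω : ℝ) * Complex.I - (t * Y ω : ℝ) ^ 2 / 2)) ∂P := by
    rw [integral_sub ie i3, integral_sub i12 i2c, integral_add (integrable_const _) i1c, e1]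
    congr 1
    have a1 : ∫ ω, ((t * Y ω : ℝ) : ℂ) * Complex.I ∂P = 0 := by
      rw [integral_mul_const, integral_complex_ofReal, integral_const_mul, h0]
      simp
    have a2 : ∫ ω, ((t * Y ω : ℝ) : ℂ) ^ 2 / 2 ∂P = ((t ^ 2 / 2 * ∫ ω, Y ω ^ 2 ∂P : ℝ) : ℂ) := by
      rw [← integral_const_mul, ← integral_complex_ofReal]
      refine integral_congr_ae (ae_of_all _ fun ω => ?_)
      push_cast
      ring
    rw [a1, a2]
    simp
  rw [e2]
  refine (norm_integral_le_integral_norm _).trans ?_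
  rw [← integral_indicator ms, ← integral_const_mul, ← integral_const_mul, ← integral_add
    ((i2.indicator ms).const_mul _) (i2.const_mul _)]
  refine integral_mono_ae (ie.sub i3).norm
    (((i2.indicator ms).const_mul _).add (i2.const_mul _)) (ae_of_all _ fun ω => ?_)
  beta_reduce
  by_cases hω : δ < |Y ω|
  · have h : 0 ≤ 4 * |t| ^ 3 * δ * Y ω ^ 2 := by positivity
    refine (norm_exp_mul_I_sub_le_sq _).trans ?_
    rw [indicator_of_mem (s := {ω | δ < |Y ω|}) hω]
    linarith
  · refine (norm_exp_mul_I_sub_le_mul_cube _).trans ?_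
    rw [indicator_of_notMem (s := {ω | δ < |Y ω|}) hω, mul_zero, zero_add, abs_mul, mul_pow]
    have : |Y ω| ^ 3 ≤ δ * Y ω ^ 2 := by
      rw [pow_succ', sq_abs]
      exact mul_le_mul_of_nonneg_right (not_lt.1 hω) (sq_nonneg _)
    calc 4 * (|t| ^ 3 * |Y ω| ^ 3) ≤ 4 * (|t| ^ 3 * (δ * Y ω ^ 2)) := by gcongr
      _ = _ := by ring

/-- Under Lindeberg's condition this makes the largest variance in a row small. -/
lemma integral_sq_le_sq_add_setIntegral {Y : Ω → ℝ} (mY : Measurable Y) (h2 : MemLp Y 2 P)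
    (δ : ℝ) :
    ∫ ω, Y ω ^ 2 ∂P ≤ δ ^ 2 + ∫ ω in {ω | δ < |Y ω|}, Y ω ^ 2 ∂P := by
  have ms : MeasurableSet {ω | δ < |Y ω|} := measurableSet_lt measurable_const (by fun_prop)
  have i2 : Integrable (fun ω => Y ω ^ 2) P := h2.integrable_sq
  have e : δ ^ 2 = ∫ _, δ ^ 2 ∂P := by simp
  rw [← integral_indicator ms, e, ← integral_add (integrable_const _) (i2.indicator ms)]
  refine integral_mono_ae i2 ((integrable_const _).add (i2.indicator ms))
    (ae_of_all _ fun ω => ?_)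
  beta_reduce
  by_cases hω : δ < |Y ω|
  · rw [indicator_of_mem (s := {ω | δ < |Y ω|}) hω]
    linarith [sq_nonneg δ]
  · rw [indicator_of_notMem (s := {ω | δ < |Y ω|}) hω, add_zero]
    exact sq_le_sq' (by linarith [neg_abs_le (Y ω), not_lt.1 hω])
      ((le_abs_self _).trans (not_lt.1 hω))

/-- Both sides are products over `s`, compared factor by factor through `1 - t² σᵢ² / 2`. In the
error `(t² σᵢ² / 2)²` of the exponential, one `σᵢ²` is bounded uniformly in `i` and the other is
kept for the sum. -/
lemma norm_charFun_map_sum_sub_exp_le {ι : Type*} (s : Finset ι) {Y : ι → Ω → ℝ}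
    (mY : ∀ i, Measurable (Y i)) (hY : iIndepFun Y P) (h2 : ∀ i ∈ s, MemLp (Y i) 2 P)
    (h0 : ∀ i ∈ s, ∫ ω, Y i ω ∂P = 0) {δ : ℝ} (hδ : 0 ≤ δ) (t : ℝ) :
    ‖charFun (P.map fun ω => ∑ i ∈ s, Y i ω) t -
        (Real.exp (-(t ^ 2 / 2 * ∑ i ∈ s, ∫ ω, Y i ω ^ 2 ∂P)) : ℂ)‖ ≤
      4 * t ^ 2 * ∑ i ∈ s, ∫ ω in {ω | δ < |Y i ω|}, Y i ω ^ 2 ∂P +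
        (4 * |t| ^ 3 * δ + (t ^ 2 / 2) ^ 2 *
          (δ ^ 2 + ∑ i ∈ s, ∫ ω in {ω | δ < |Y i ω|}, Y i ω ^ 2 ∂P)) *
        ∑ i ∈ s, ∫ ω, Y i ω ^ 2 ∂P := by
  have hv : ∀ i, 0 ≤ ∫ ω, Y i ω ^ 2 ∂P := fun i => integral_nonneg fun ω => sq_nonneg _
  have hl : ∀ i, 0 ≤ ∫ ω in {ω | δ < |Y i ω|}, Y i ω ^ 2 ∂P :=
    fun i => integral_nonneg fun ω => sq_nonneg _
  have hmap : ∀ i, IsProbabilityMeasure (P.map (Y i)) := fun i =>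
    Measure.isProbabilityMeasure_map (mY i).aemeasurable
  have hexp : ∀ i, ‖(Real.exp (-(t ^ 2 / 2 * ∫ ω, Y i ω ^ 2 ∂P)) : ℂ)‖ ≤ 1 := fun i => by
    rw [Complex.norm_real, Real.norm_eq_abs, Real.abs_exp, Real.exp_le_one_iff, neg_nonpos]
    exact mul_nonneg (by positivity) (hv i)
  rw [(hY.precomp Subtype.val_injective).charFun_map_fun_finsetSum_eq_prod
      (fun i _ => (mY i).aemeasurable), Finset.prod_apply, Finset.mul_sum, ← Finset.sum_neg_distrib,
    Real.exp_sum, Complex.ofReal_prod]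
  refine (norm_prod_sub_prod_le_sum s (fun i _ => norm_charFun_le_one t)
    (fun i _ => hexp i)).trans ?_
  rw [Finset.mul_sum s _ (4 * t ^ 2), Finset.mul_sum s _ (4 * |t| ^ 3 * δ + _),
    ← Finset.sum_add_distrib]
  refine Finset.sum_le_sum fun i hi => ?_
  have b1 := norm_charFun_map_sub_le (mY i) (h2 i hi) (h0 i hi) hδ t
  have b2 := abs_exp_neg_sub_one_sub_le (x := t ^ 2 / 2 * ∫ ω, Y i ω ^ 2 ∂P)
    (mul_nonneg (by positivity) (hv i))
  have b3 : ∫ ω, Y i ω ^ 2 ∂P ≤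
      δ ^ 2 + ∑ i ∈ s, ∫ ω in {ω | δ < |Y i ω|}, Y i ω ^ 2 ∂P :=
    (integral_sq_le_sq_add_setIntegral (mY i) (h2 i hi) δ).trans (by
      gcongr
      exact Finset.single_le_sum (f := fun i => ∫ ω in {ω | δ < |Y i ω|}, Y i ω ^ 2 ∂P)
        (fun i _ => hl i) hi)
  have b4 := norm_sub_le_norm_sub_add_norm_sub (charFun (P.map (Y i)) t)
    (1 - t ^ 2 / 2 * ∫ ω, Y i ω ^ 2 ∂P : ℝ) (Real.exp (-(t ^ 2 / 2 * ∫ ω, Y i ω ^ 2 ∂P)) : ℂ)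
  rw [← Complex.ofReal_sub, Complex.norm_real, Real.norm_eq_abs, abs_sub_comm (1 - _)] at b4
  refine b4.trans ((add_le_add b1 b2).trans ?_)
  have b5 : (t ^ 2 / 2 * ∫ ω, Y i ω ^ 2 ∂P) ^ 2 ≤ (t ^ 2 / 2) ^ 2 *
      (δ ^ 2 + ∑ i ∈ s, ∫ ω in {ω | δ < |Y i ω|}, Y i ω ^ 2 ∂P) * ∫ ω, Y i ω ^ 2 ∂P := by
    rw [mul_pow, mul_assoc, sq (∫ ω, Y i ω ^ 2 ∂P)]
    gcongr
  linarith

/-- **Lindeberg's theorem** for a triangular array with row variances `v`, in terms of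
characteristic functions. -/
theorem tendsto_charFun_sum_of_lindeberg {ι : Type*} {s : ℕ → Finset ι} {Y : ℕ → ι → Ω → ℝ}
    (mY : ∀ n i, Measurable (Y n i)) (hY : ∀ n, iIndepFun (Y n) P)
    (h2 : ∀ n, ∀ i ∈ s n, MemLp (Y n i) 2 P) (h0 : ∀ n, ∀ i ∈ s n, ∫ ω, Y n i ω ∂P = 0)
    {v : ℝ} (hv : ∀ n, ∑ i ∈ s n, ∫ ω, Y n i ω ^ 2 ∂P = v)
    (hL : ∀ δ : ℝ, 0 < δ →
      Tendsto (fun n => ∑ i ∈ s n, ∫ ω in {ω | δ < |Y n i ω|}, Y n i ω ^ 2 ∂P) atTop (𝓝 0))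
    (t : ℝ) :
    Tendsto (fun n => charFun (P.map fun ω => ∑ i ∈ s n, Y n i ω) t) atTop
      (𝓝 (Real.exp (-(t ^ 2 / 2 * v)) : ℂ)) := by
  rw [tendsto_iff_norm_sub_tendsto_zero]
  refine tendsto_order.2 ⟨fun a ha => .of_forall fun n => ha.trans_le (norm_nonneg _),
    fun a ha => ?_⟩
  -- `δ` is fixed first, so that the limit of the error bound in `n` is below `a`; only then does
  -- `n` grow.
  have hδ : Tendsto (fun δ : ℝ => 4 * t ^ 2 * 0 + (4 * |t| ^ 3 * δ + (t ^ 2 / 2) ^ 2 *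
      (δ ^ 2 + 0)) * v) (𝓝[>] 0) (𝓝 0) := by
    refine tendsto_nhdsWithin_of_tendsto_nhds (Continuous.tendsto' (by fun_prop) _ _ (by simp))
  obtain ⟨δ, hδa, hδ0⟩ :=
    ((hδ.eventually (gt_mem_nhds ha)).and self_mem_nhdsWithin).exists
  have hlim : Tendsto (fun n =>
      4 * t ^ 2 * ∑ i ∈ s n, ∫ ω in {ω | δ < |Y n i ω|}, Y n i ω ^ 2 ∂P +
        (4 * |t| ^ 3 * δ + (t ^ 2 / 2) ^ 2 *
          (δ ^ 2 + ∑ i ∈ s n, ∫ ω in {ω | δ < |Y n i ω|}, Y n i ω ^ 2 ∂P)) * v) atTop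
      (𝓝 (4 * t ^ 2 * 0 + (4 * |t| ^ 3 * δ + (t ^ 2 / 2) ^ 2 * (δ ^ 2 + 0)) * v)) :=
    ((hL δ hδ0).const_mul _).add
      (((((hL δ hδ0).const_add _).const_mul _).const_add _).mul_const _)
  filter_upwards [hlim.eventually (gt_mem_nhds hδa)] with n hn
  refine lt_of_le_of_lt ?_ hn
  have := norm_charFun_map_sum_sub_exp_le (s n) (mY n) (hY n) (h2 n) (h0 n)
    (le_of_lt hδ0) t
  rwa [hv n] at this

/-- **Lindeberg's theorem**: the distribution functions of the row sums converge to that of the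
normal distribution. -/
theorem tendsto_measureReal_sum_le_of_lindeberg {ι : Type*} {s : ℕ → Finset ι}
    {Y : ℕ → ι → Ω → ℝ}
    (mY : ∀ n i, Measurable (Y n i)) (hY : ∀ n, iIndepFun (Y n) P)
    (h2 : ∀ n, ∀ i ∈ s n, MemLp (Y n i) 2 P) (h0 : ∀ n, ∀ i ∈ s n, ∫ ω, Y n i ω ∂P = 0)
    {v : NNReal} (hv0 : v ≠ 0) (hv : ∀ n, ∑ i ∈ s n, ∫ ω, Y n i ω ^ 2 ∂P = v)
    (hL : ∀ δ : ℝ, 0 < δ →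
      Tendsto (fun n => ∑ i ∈ s n, ∫ ω in {ω | δ < |Y n i ω|}, Y n i ω ^ 2 ∂P) atTop (𝓝 0))
    (u : ℝ) :
    Tendsto (fun n => P.real {ω | ∑ i ∈ s n, Y n i ω ≤ u}) atTop
      (𝓝 ((gaussianReal 0 v).real (Iic u))) := by
  have mS : ∀ n, Measurable fun ω => ∑ i ∈ s n, Y n i ω := fun n =>
    Finset.measurable_sum _ fun i _ => mY n i
  let Q : ℕ → ProbabilityMeasure ℝ := fun n =>
    ⟨P.map fun ω => ∑ i ∈ s n, Y n i ω, Measure.isProbabilityMeasure_map (mS n).aemeasurable⟩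
  let G : ProbabilityMeasure ℝ := ⟨gaussianReal 0 v, inferInstance⟩
  -- Lévy's continuity theorem; afterwards `Iic u` is a continuity set because a nondegenerate
  -- normal law has no atoms.
  have hQ : Tendsto Q atTop (𝓝 G) := by
    refine ProbabilityMeasure.tendsto_iff_tendsto_charFun.2 fun t => ?_
    have e : charFun (gaussianReal 0 v) t = (Real.exp (-(t ^ 2 / 2 * v)) : ℂ) := by
      rw [charFun_gaussianReal]
      push_cast
      congr 1
      simp
      ring
    change Tendsto _ _ (𝓝 (charFun (gaussianReal 0 v) t))
    rw [e]
    exact tendsto_charFun_sum_of_lindeberg mY hY h2 h0 hv hL t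
  have : NullSingletonClass (G : Measure ℝ) := nullSingletonClass_gaussianReal (μ := 0) hv0
  have hlim := ProbabilityMeasure.tendsto_measure_of_null_frontier_of_tendsto' hQ
    (E := Iic u) (by
      rw [frontier_Iic]
      exact measure_singleton u)
  have := (ENNReal.tendsto_toReal (measure_ne_top (G : Measure ℝ) (Iic u))).comp hlim
  refine this.congr fun n => ?_
  change ((P.map fun ω => ∑ i ∈ s n, Y n i ω) (Iic u)).toReal = _
  rw [Measure.map_apply (mS n) measurableSet_Iic]
  rfl

end Lindeberg

/-! ### Pólya's and Slutsky's theorems; the Gauss function -/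

section DistributionFunctions

/-- **Pólya's theorem**: pointwise convergence of distribution functions to a continuous
distribution function is uniform. -/
theorem tendstoUniformly_of_monotone_of_continuous {F : ℕ → ℝ → ℝ} {G : ℝ → ℝ}
    (hF : ∀ n, Monotone (F n)) (hF0 : ∀ n u, 0 ≤ F n u) (hF1 : ∀ n u, F n u ≤ 1)
    (hG : Monotone G) (hGc : Continuous G) (hG0 : Tendsto G atBot (𝓝 0))
    (hG1 : Tendsto G atTop (𝓝 1)) (hlim : ∀ u, Tendsto (fun n => F n u) atTop (𝓝 (G u))) :
    TendstoUniformly F G atTop := by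
  have G0 : ∀ u, 0 ≤ G u := fun u => hG.le_of_tendsto hG0 u
  have G1 : ∀ u, G u ≤ 1 := fun u => hG.ge_of_tendsto hG1 u
  -- Quantiles of `G` exist at levels strictly between 0 and 1; at other levels the value is a dummy
  -- and is never used.
  have hsurj : ∀ y : ℝ, ∃ x, 0 < y → y < 1 → G x = y := fun y => by
    by_cases hy : 0 < y ∧ y < 1
    · obtain ⟨a, ha⟩ := (hG0.eventually (gt_mem_nhds hy.1)).exists
      obtain ⟨b, hb⟩ := (hG1.eventually (lt_mem_nhds hy.2)).exists
      obtain ⟨x, hx⟩ := mem_range_of_exists_le_of_exists_ge hGc ⟨a, ha.le⟩ ⟨b, hb.le⟩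
      exact ⟨x, fun _ _ => hx⟩
    · exact ⟨0, fun h h' => absurd ⟨h, h'⟩ hy⟩
  choose x hx using hsurj
  rw [Metric.tendstoUniformly_iff]
  intro ε hε
  obtain ⟨m, hm⟩ := exists_nat_one_div_lt (half_pos hε)
  set M : ℝ := m + 1 with hM
  have hM0 : 0 < M := by positivity
  have hnodes : ∀ᶠ n in atTop, ∀ j ∈ Finset.range (m + 1),
      |F n (x (j / M)) - G (x (j / M))| < ε / 2 := by
    rw [Filter.eventually_all_finset]
    intro j _
    have := Metric.tendsto_nhds.1 (hlim (x (j / M))) (ε / 2) (half_pos hε)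
    simpa only [Real.dist_eq] using this
  filter_upwards [hnodes] with n hn u
  rw [dist_comm, Real.dist_eq, abs_sub_lt_iff]
  have hMG : 0 ≤ M * G u := mul_nonneg hM0.le (G0 u)
  constructor
  -- The first level `j / M` strictly above `G u`; strictness forces its quantile to lie to the
  -- right of `u`. If the level is at least 1, then `F n u ≤ 1` suffices.
  · set j := ⌊M * G u⌋₊ + 1 with hj
    have h1 : M * G u < j := by rw [hj]; push_cast; exact Nat.lt_floor_add_one _
    have h2 : (j : ℝ) ≤ M * G u + 1 := by rw [hj]; push_cast; gcongr; exact Nat.floor_le hMG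
    have h3 : (j : ℝ) / M ≤ G u + 1 / M := by
      rw [div_le_iff₀ hM0]; field_simp; linarith
    have h4 : G u < j / M := by rw [lt_div_iff₀ hM0]; linarith
    rcases lt_or_ge j (m + 1) with hjm | hjm
    · have hlt1 : (j : ℝ) / M < 1 := by
        rw [div_lt_one hM0, hM]; exact_mod_cast hjm
      have e := hx (j / M) ((G0 u).trans_lt h4) hlt1
      have hux : u ≤ x (j / M) := (hG.reflect_lt (by rwa [e])).le
      have := hn j (Finset.mem_range.2 hjm)
      rw [e, abs_sub_lt_iff] at this
      linarith [hF n hux, this.1]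
    · have : 1 ≤ (j : ℝ) / M := by
        rw [one_le_div hM0, hM]; exact_mod_cast hjm
      linarith [hF1 n u]
  -- Symmetrically, the last level strictly below `G u`. If no positive level lies below, then `F n
  -- u ≥ 0` suffices.
  · rcases le_or_gt (M * G u) 1 with hle | hgt
    · have : G u ≤ 1 / M := by rw [le_div_iff₀ hM0]; linarith
      linarith [hF0 n u]
    · obtain ⟨j, hj⟩ : ∃ j, ⌈M * G u⌉₊ = j + 1 :=
        Nat.exists_eq_succ_of_ne_zero (Nat.ceil_pos.2 (by linarith)).ne'
      have h1 : M * G u ≤ j + 1 := by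
        have := Nat.le_ceil (M * G u)
        rw [hj] at this
        exact_mod_cast this
      have h2 : (j : ℝ) < M * G u := by
        rw [← Nat.lt_ceil, hj]; exact Nat.lt_succ_self j
      have h0 : 0 < (j : ℝ) / M := div_pos (by
        have : 1 < j + 1 := by rw [← hj, Nat.lt_ceil]; exact_mod_cast hgt
        exact_mod_cast Nat.lt_of_succ_lt_succ this) hM0
      have h3 : G u ≤ j / M + 1 / M := by
        rw [← add_div, le_div_iff₀ hM0]; linarith
      have h4 : (j : ℝ) / M < G u := by rw [div_lt_iff₀ hM0]; linarith
      have h5 : (j : ℝ) < m + 1 := by nlinarith [G1 u]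
      have e := hx (j / M) h0 (h4.trans_le (G1 u))
      have hux : x (j / M) ≤ u := (hG.reflect_lt (by rwa [e])).le
      have := hn j (Finset.mem_range.2 (by exact_mod_cast h5))
      rw [e, abs_sub_lt_iff] at this
      linarith [hF n hux, this.2]

/-- **Slutsky's theorem** for distribution functions; the `D n` need not be measurable. -/
theorem tendsto_measureReal_le_of_sub {Ω : Type*} [MeasurableSpace Ω] {P : Measure Ω}
    [IsProbabilityMeasure P] {D L : ℕ → Ω → ℝ} {G : ℝ → ℝ} (hG : Continuous G)
    (hL : ∀ u, Tendsto (fun n => P.real {ω | L n ω ≤ u}) atTop (𝓝 (G u)))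
    (hDL : ∀ η : ℝ, 0 < η → Tendsto (fun n => P.real {ω | η ≤ |D n ω - L n ω|}) atTop (𝓝 0))
    (u : ℝ) : Tendsto (fun n => P.real {ω | D n ω ≤ u}) atTop (𝓝 (G u)) := by
  -- Only monotonicity and subadditivity of outer measure enter, so no measurability is needed. It
  -- is used with `D` and `L` in both orders.
  have key : ∀ (A B : ℕ → Ω → ℝ) (w η : ℝ) (n : ℕ),
      P.real {ω | A n ω ≤ w} ≤
        P.real {ω | B n ω ≤ w + η} + P.real {ω | η ≤ |A n ω - B n ω|} := by
    intro A B w η n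
    refine (measureReal_mono (fun ω hω => ?_)).trans (measureReal_union_le _ _)
    simp only [mem_ofPred_eq, mem_union] at hω ⊢
    by_contra! h
    linarith [neg_abs_le (A n ω - B n ω)]
  refine tendsto_order.2 ⟨fun a ha => ?_, fun a ha => ?_⟩
  · have h1 : Tendsto (fun η => G (u - η)) (𝓝[>] 0) (𝓝 (G u)) :=
      tendsto_nhdsWithin_of_tendsto_nhds (Continuous.tendsto' (by fun_prop) _ _ (by simp))
    obtain ⟨η, hη, hη0⟩ := ((h1.eventually (lt_mem_nhds ha)).and self_mem_nhdsWithin).exists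
    have h2 := (hL (u - η)).sub (hDL η hη0)
    rw [sub_zero] at h2
    filter_upwards [h2.eventually (lt_mem_nhds hη)] with n hn
    have := key L D (u - η) η n
    simp only [abs_sub_comm (L n _), sub_add_cancel] at this
    linarith
  · have h1 : Tendsto (fun η => G (u + η)) (𝓝[>] 0) (𝓝 (G u)) :=
      tendsto_nhdsWithin_of_tendsto_nhds (Continuous.tendsto' (by fun_prop) _ _ (by simp))
    obtain ⟨η, hη, hη0⟩ := ((h1.eventually (gt_mem_nhds ha)).and self_mem_nhdsWithin).exists
    have h2 := (hL (u + η)).add (hDL η hη0)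
    rw [add_zero] at h2
    filter_upwards [h2.eventually (gt_mem_nhds hη)] with n hn
    exact (key D L u η n).trans_lt hn

/-- The density `π^(-1/2) exp (-t²)` belongs to variance 1/2, which accounts for the factors `√2`
below. -/
lemma gaussPhi_eq_gaussianReal (u : ℝ) :
    gaussPhi u = (gaussianReal 0 (1 / 2)).real (Iic u) := by
  rw [measureReal_def, gaussianReal_apply_eq_integral 0 (by norm_num),
    ENNReal.toReal_ofReal (integral_nonneg fun x => gaussianPDFReal_nonneg _ _ _), gaussPhi,
    ← integral_const_mul]
  congr 1
  ext t
  rw [gaussianPDFReal]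
  norm_num
  field_simp

lemma gaussPhi_eq_cdf : gaussPhi = cdf (gaussianReal 0 (1 / 2)) := by
  ext u
  rw [gaussPhi_eq_gaussianReal, cdf_eq_real]

lemma continuous_gaussPhi : Continuous gaussPhi := by
  have hint : Integrable fun t : ℝ => Real.exp (-t ^ 2) := by
    simpa using integrable_exp_neg_mul_sq one_pos
  refine continuous_const.mul ?_
  have e : (fun u : ℝ => ∫ t in Iic u, Real.exp (-t ^ 2)) =
      fun u => (∫ t in Iic (0 : ℝ), Real.exp (-t ^ 2)) + ∫ t in (0 : ℝ)..u, Real.exp (-t ^ 2) := by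
    ext u
    rw [← intervalIntegral.integral_Iic_sub_Iic hint.integrableOn hint.integrableOn]
    ring
  rw [e]
  exact continuous_const.add
    (intervalIntegral.continuous_primitive (fun a b => hint.intervalIntegrable) 0)

end DistributionFunctions

/-! ### Integrals and distribution functions of averaged measures -/

section Averages

variable {k : ℕ}

lemma distFun_smul_sum (ν : ℕ → Measure (Fin k → ℝ)) [∀ i, IsFiniteMeasure (ν i)] (n : ℕ)
    (x : Fin k → ℝ) :
    distFun ((n : ℝ≥0∞)⁻¹ • ∑ i ∈ Finset.range n, ν i) x =
      (n : ℝ)⁻¹ * ∑ i ∈ Finset.range n, distFun (ν i) x := by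
  simp only [distFun, measureReal_def, Measure.smul_apply, Measure.finsetSum_apply, smul_eq_mul,
    ENNReal.toReal_mul, ENNReal.toReal_inv, ENNReal.toReal_natCast]
  rw [ENNReal.toReal_sum fun i _ => measure_ne_top _ _]

lemma distFun_dirac (y x : Fin k → ℝ) :
    distFun (Measure.dirac y) x = (Iic x).indicator (fun _ => (1 : ℝ)) y := by
  rw [distFun, measureReal_def, Measure.dirac_apply' _ measurableSet_Iic]
  by_cases h : y ∈ Iic x <;> simp [h]

lemma integral_smul_sum {g : (Fin k → ℝ) → ℝ} {ν : ℕ → Measure (Fin k → ℝ)} {n : ℕ}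
    (h : ∀ i < n, Integrable g (ν i)) :
    ∫ y, g y ∂((n : ℝ≥0∞)⁻¹ • ∑ i ∈ Finset.range n, ν i) =
      (n : ℝ)⁻¹ * ∑ i ∈ Finset.range n, ∫ y, g y ∂(ν i) := by
  rw [integral_smul_measure, integral_finsetSum_measure fun i hi => h i (Finset.mem_range.1 hi)]
  simp

lemma integrable_of_integrable_meanDist {g : (Fin k → ℝ) → ℝ} {V' : ℕ → Measure (Fin k → ℝ)}
    {n : ℕ} (h : Integrable g (meanDist V' n)) {i : ℕ} (hi : i < n) : Integrable g (V' i) := by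
  have hn : (n : ℝ≥0∞) ≠ 0 := by exact_mod_cast (Nat.zero_lt_of_lt hi).ne'
  rw [meanDist, integrable_smul_measure (by simp) (by simpa using hn),
    integrable_finsetSum_measure] at h
  exact h i (Finset.mem_range.2 hi)

/-- This turns the linear term of the expansion into a normalized sum of centred independent
variables. -/
lemma integralDiff_empiricalDist_meanDist {g : (Fin k → ℝ) → ℝ} {V' : ℕ → Measure (Fin k → ℝ)}
    {n : ℕ} (h : Integrable g (meanDist V' n)) (x : ℕ → Fin k → ℝ) :
    integralDiff g (empiricalDist x n) (meanDist V' n) =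
      (n : ℝ)⁻¹ * ∑ i ∈ Finset.range n, (g (x i) - ∫ y, g y ∂(V' i)) := by
  rw [integralDiff, empiricalDist, meanDist, integral_smul_sum fun i _ => ?_,
    integral_smul_sum fun i hi => integrable_of_integrable_meanDist h hi, Finset.sum_sub_distrib,
    mul_sub]
  · simp
  · exact integrable_dirac (by simp)

end Averages

/-! ### Mean size of the quadratic term -/

section SecondOrderTerm

variable {k : ℕ} {Ω : Type*} [MeasurableSpace Ω] {μ : Measure Ω} [IsProbabilityMeasure μ]
  {V' : ℕ → Measure (Fin k → ℝ)} {X : ℕ → Ω → Fin k → ℝ}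

lemma distFun_empiricalDist (x : ℕ → Fin k → ℝ) (n : ℕ) (y : Fin k → ℝ) :
    distFun (empiricalDist x n) y =
      (n : ℝ)⁻¹ * ∑ i ∈ Finset.range n, (Iic y).indicator (fun _ => (1 : ℝ)) (x i) := by
  simp only [empiricalDist, distFun_smul_sum, distFun_dirac]

/-- The mean square deviation of the empirical distribution function. -/
lemma integral_sq_distFun_sub_le (hX : ∀ ν, Measurable (X ν)) (hlaw : ∀ ν, μ.map (X ν) = V' ν)
    (hindep : iIndepFun X μ) {n : ℕ} (hn : n ≠ 0) (x : Fin k → ℝ) :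
    Integrable (fun ω => (distFun (meanDist V' n) x
        - distFun (empiricalDist (fun i => X i ω) n) x) ^ 2) μ ∧
    ∫ ω, (distFun (meanDist V' n) x - distFun (empiricalDist (fun i => X i ω) n) x) ^ 2 ∂μ ≤
      (n : ℝ)⁻¹ * (distFun (meanDist V' n) x * (1 - distFun (meanDist V' n) x)) := by
  have hprob : ∀ i, IsProbabilityMeasure (V' i) := fun i => by
    rw [← hlaw i]
    exact Measure.isProbabilityMeasure_map (hX i).aemeasurable
  have hn0 : (0 : ℝ) < n := by positivity
  have mI : Measurable ((Iic x).indicator fun _ : Fin k → ℝ => (1 : ℝ)) :=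
    measurable_const.indicator measurableSet_Iic
  set Z : ℕ → Ω → ℝ := fun i ω => (Iic x).indicator (fun _ => (1 : ℝ)) (X i ω) with hZ
  set p : ℕ → ℝ := fun i => distFun (V' i) x with hp
  have mZ : ∀ i, Measurable (Z i) := fun i => mI.comp (hX i)
  have hZ2 : ∀ i, MemLp (Z i) 2 μ := fun i =>
    MemLp.of_bound (mZ i).aestronglyMeasurable 1 (ae_of_all _ fun ω => by
      simp only [hZ]
      by_cases h : X i ω ∈ Iic x <;> simp [h])
  have hEZ : ∀ i, ∫ ω, Z i ω ∂μ = p i := fun i => by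
    rw [hp]
    simp only [distFun]
    rw [← integral_map (hX i).aemeasurable mI.aestronglyMeasurable, hlaw,
      integral_indicator measurableSet_Iic]
    simp
  have hVarZ : ∀ i, Var[Z i; μ] = p i - p i ^ 2 := fun i => by
    -- An indicator equals its own square, hence the variance `p - p²`.
    rw [variance_eq_sub (hZ2 i), hEZ]
    congr 1
    rw [← hEZ]
    congr 1
    ext ω
    simp only [hZ, Pi.pow_apply]
    by_cases h : X i ω ∈ Iic x <;> simp [h]
  have hindZ : iIndepFun Z μ := hindep.comp (fun _ => (Iic x).indicator fun _ => (1 : ℝ))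
    fun _ => mI
  have hvar : Var[∑ i ∈ Finset.range n, Z i; μ] = ∑ i ∈ Finset.range n, (p i - p i ^ 2) := by
    rw [IndepFun.variance_sum (fun i _ => hZ2 i)
      (fun i _ j _ hij => hindZ.indepFun hij)]
    exact Finset.sum_congr rfl fun i _ => hVarZ i
  have hsum2 : MemLp (∑ i ∈ Finset.range n, Z i) 2 μ := memLp_finsetSum' _ fun i _ => hZ2 i
  have hES : ∫ ω, (∑ i ∈ Finset.range n, Z i) ω ∂μ = ∑ i ∈ Finset.range n, p i := by
    simp only [Finset.sum_apply]
    rw [integral_finsetSum _ fun i _ => (hZ2 i).integrable (by norm_num)]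
    exact Finset.sum_congr rfl fun i _ => hEZ i
  have hV : distFun (meanDist V' n) x = (n : ℝ)⁻¹ * ∑ i ∈ Finset.range n, p i :=
    distFun_smul_sum V' n x
  have hT : ∀ ω, (distFun (meanDist V' n) x
      - distFun (empiricalDist (fun i => X i ω) n) x) ^ 2 = ((n : ℝ)⁻¹) ^ 2 *
        ((∑ i ∈ Finset.range n, Z i) ω - ∑ i ∈ Finset.range n, p i) ^ 2 := fun ω => by
    rw [distFun_empiricalDist, hV, Finset.sum_apply]
    ring
  simp only [hT]
  refine ⟨((hsum2.sub (memLp_const _)).integrable_sq).const_mul _, ?_⟩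
  rw [integral_const_mul]
  have hv := variance_eq_integral hsum2.aemeasurable
  rw [hES, hvar] at hv
  rw [← hv, hV, Finset.sum_sub_distrib]
  -- By Cauchy–Schwarz, unequal `p i` only lower the variance below the value for identically
  -- distributed trials.
  have hcs := sq_sum_le_card_mul_sum_sq (s := Finset.range n) (f := p)
  rw [Finset.card_range] at hcs
  have : ((n : ℝ)⁻¹) ^ 2 * (n : ℝ)⁻¹ * (∑ i ∈ Finset.range n, p i) ^ 2 ≤
      ((n : ℝ)⁻¹) ^ 2 * (n : ℝ)⁻¹ * (n * ∑ i ∈ Finset.range n, p i ^ 2) := by gcongr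
  have e : ((n : ℝ)⁻¹) ^ 2 * (n : ℝ)⁻¹ * (n * ∑ i ∈ Finset.range n, p i ^ 2) =
      ((n : ℝ)⁻¹) ^ 2 * ∑ i ∈ Finset.range n, p i ^ 2 := by field_simp
  nlinarith

/-- Joint measurability for Tonelli's theorem. Continuity of the distribution functions supplies it
for `Vₙ`; for `Sₙ` it comes from measurability of `{(ω, x) | X i ω ≤ x}`. -/
lemma measurable_distFun_sub (hX : ∀ ν, Measurable (X ν)) (hlaw : ∀ ν, μ.map (X ν) = V' ν)
    (hcont : ∀ ν, Continuous (distFun (V' ν))) (n : ℕ) :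
    Measurable fun q : Ω × (Fin k → ℝ) => distFun (meanDist V' n) q.2
        - distFun (empiricalDist (fun i => X i q.1) n) q.2 := by
  have hprob : ∀ i, IsProbabilityMeasure (V' i) := fun i => by
    rw [← hlaw i]
    exact Measure.isProbabilityMeasure_map (hX i).aemeasurable
  simp only [distFun_empiricalDist, meanDist, distFun_smul_sum]
  refine Measurable.sub ?_ ?_
  · exact (Finset.measurable_sum _ fun i _ =>
      (hcont i).measurable.comp measurable_snd).const_mul _
  · refine (Finset.measurable_sum _ fun i _ => ?_).const_mul _
    have : (fun q : Ω × (Fin k → ℝ) => (Iic q.2).indicator (fun _ => (1 : ℝ)) (X i q.1)) =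
        {q : Ω × (Fin k → ℝ) | X i q.1 ≤ q.2}.indicator fun _ => (1 : ℝ) := by
      ext q
      by_cases h : X i q.1 ≤ q.2 <;> simp [h]
    rw [this]
    exact measurable_const.indicator
      (measurableSet_le ((hX i).comp measurable_fst) measurable_snd)

lemma lintegral_lintegral_sq_distFun_sub_le (hX : ∀ ν, Measurable (X ν))
    (hlaw : ∀ ν, μ.map (X ν) = V' ν) (hindep : iIndepFun X μ)
    (hcont : ∀ ν, Continuous (distFun (V' ν))) {ψ : (Fin k → ℝ) → ℝ} (hψ : Measurable ψ)
    (hψ0 : ∀ x, 0 ≤ ψ x) {n : ℕ} (hn : n ≠ 0) :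
    ∫⁻ ω, (∫⁻ x, ENNReal.ofReal (ψ x * (distFun (meanDist V' n) x
        - distFun (empiricalDist (fun i => X i ω) n) x) ^ 2)) ∂μ ≤
      (n : ℝ≥0∞)⁻¹ * ∫⁻ x, ENNReal.ofReal (ψ x * (distFun (meanDist V' n) x
          * (1 - distFun (meanDist V' n) x))) := by
  have m := measurable_distFun_sub hX hlaw hcont n
  rw [lintegral_lintegral_swap (by
    exact (((hψ.comp measurable_snd).mul (m.pow_const 2)).ennreal_ofReal).aemeasurable),
    ← lintegral_const_mul' _ _ (by simpa using hn)]
  refine lintegral_mono fun x => ?_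
  obtain ⟨hi, hle⟩ := integral_sq_distFun_sub_le hX hlaw hindep hn x
  rw [← ofReal_integral_eq_lintegral_ofReal (hi.const_mul _)
    (ae_of_all _ fun ω => mul_nonneg (hψ0 x) (sq_nonneg _)), integral_const_mul]
  have e : (n : ℝ≥0∞)⁻¹ = ENNReal.ofReal (n : ℝ)⁻¹ := by
    rw [ENNReal.ofReal_inv_of_pos (by positivity), ENNReal.ofReal_natCast]
  rw [e, ← ENNReal.ofReal_mul (by positivity)]
  refine ENNReal.ofReal_le_ofReal ?_
  calc _ ≤ ψ x * ((n : ℝ)⁻¹ * (distFun (meanDist V' n) x * (1 - distFun (meanDist V' n) x))) :=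
        mul_le_mul_of_nonneg_left hle (hψ0 x)
    _ = _ := by ring

lemma measurable_lintegral_sq_distFun_sub (hX : ∀ ν, Measurable (X ν))
    (hlaw : ∀ ν, μ.map (X ν) = V' ν)
    (hcont : ∀ ν, Continuous (distFun (V' ν))) {ψ : (Fin k → ℝ) → ℝ} (hψ : Measurable ψ) (n : ℕ) :
    Measurable fun ω => ∫⁻ x, ENNReal.ofReal (ψ x * (distFun (meanDist V' n) x
        - distFun (empiricalDist (fun i => X i ω) n) x) ^ 2) :=
  Measurable.lintegral_prod_right' (f := fun q : Ω × (Fin k → ℝ) =>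
    ENNReal.ofReal (ψ q.2 * (distFun (meanDist V' n) q.2
        - distFun (empiricalDist (fun i => X i q.1) n) q.2) ^ 2))
    ((hψ.comp measurable_snd).mul
      ((measurable_distFun_sub hX hlaw hcont n).pow_const 2)).ennreal_ofReal

end SecondOrderTerm

/-! ### The Lyapunov-type condition implies Lindeberg's -/

section LyapunovLindeberg

variable {k : ℕ} {f₁ : Measure (Fin k → ℝ) → (Fin k → ℝ) → ℝ} {V' : ℕ → Measure (Fin k → ℝ)}

lemma rowStd_sq (f₁ : Measure (Fin k → ℝ) → (Fin k → ℝ) → ℝ) (V' : ℕ → Measure (Fin k → ℝ))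
    (n : ℕ) : rowStd f₁ V' n ^ 2 = ∑ ν ∈ Finset.range n, rowVar f₁ V' n ν :=
  Real.sq_sqrt (Finset.sum_nonneg fun _ _ => integral_nonneg fun _ => sq_nonneg _)

lemma rowVar_eq {n ν : ℕ} [IsProbabilityMeasure (V' ν)]
    (h : MemLp (f₁ (meanDist V' n)) 2 (V' ν)) :
    rowVar f₁ V' n ν =
      ∫ y, f₁ (meanDist V' n) y ^ 2 ∂(V' ν) - (∫ y, f₁ (meanDist V' n) y ∂(V' ν)) ^ 2 := by
  rw [rowVar, rowMean, ← variance_eq_integral h.aemeasurable, variance_eq_sub h]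
  rfl

lemma setIntegral_sq_le_rpow_div {α : Type*} [MeasurableSpace α] {ν : Measure α}
    {h : α → ℝ} {ε c : ℝ} (hε : 0 < ε) (hc : 0 < c) (hm : AEStronglyMeasurable h ν)
    (hi : Integrable (fun y => |h y| ^ (2 + ε)) ν) :
    ∫ y in {y | c < |h y|}, h y ^ 2 ∂ν ≤ (∫ y, |h y| ^ (2 + ε) ∂ν) / c ^ ε := by
  have hs : NullMeasurableSet {y | c < |h y|} ν :=
    nullMeasurableSet_lt aemeasurable_const hm.norm.aemeasurable
  rw [← integral_div]
  refine (integral_mono_of_nonneg (ae_of_all _ fun y => sq_nonneg _)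
    (hi.div_const _).integrableOn ?_).trans
    (setIntegral_le_integral (hi.div_const _) (ae_of_all _ fun y => by positivity))
  filter_upwards [ae_restrict_mem₀ hs] with y hy
  have hy' : c < |h y| := hy
  rw [le_div_iff₀ (by positivity), Real.rpow_add (hc.trans hy'), Real.rpow_two, sq_abs]
  gcongr

/-- Each truncated second moment is at most `C / (δ sₙ)^ε`, so the Lindeberg ratio is at most `n C /
(δ^ε sₙ^(2+ε)) = C δ^(-ε) (n^(1/(2+ε)) / sₙ)^(2+ε)`, which tends to 0. -/
lemma LyapunovCondition.lindebergCondition [∀ ν, IsProbabilityMeasure (V' ν)] {ε : ℝ}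
    (hε : 0 < ε) (hint : ∀ᶠ n in atTop, ∀ ν < n, Integrable (f₁ (meanDist V' n)) (V' ν))
    (h : LyapunovCondition f₁ V' ε) : LindebergCondition f₁ V' := by
  obtain ⟨⟨C, hC⟩, hs⟩ := h
  have hp : 0 < 2 + ε := by positivity
  have hpos : ∀ᶠ n in atTop, 0 < rowStd f₁ V' n := by
    filter_upwards [hs.eventually_gt_atTop 0] with n hn
    by_contra hcon
    exact absurd hn (not_lt.2 (div_nonpos_of_nonpos_of_nonneg (not_lt.1 hcon) (by positivity)))
  refine ⟨?_, hpos, fun δ hδ => ?_⟩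
  · filter_upwards [hC, hint] with n hCn hin ν hν
    have hm : AEStronglyMeasurable
        (fun y => f₁ (meanDist V' n) y - rowMean f₁ V' n ν) (V' ν) :=
      ((hin ν hν).sub (integrable_const _)).aestronglyMeasurable
    have hL : MemLp (fun y => f₁ (meanDist V' n) y - rowMean f₁ V' n ν)
        (ENNReal.ofReal (2 + ε)) (V' ν) := by
      rw [← integrable_norm_rpow_iff hm (by simpa using hp) ENNReal.ofReal_ne_top,
        ENNReal.toReal_ofReal hp.le]
      exact (hCn ν hν).1
    have hL2 := hL.mono_exponent (p := 2) (by
      rw [← ENNReal.ofReal_ofNat]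
      exact ENNReal.ofReal_le_ofReal (by linarith))
    convert hL2.add (memLp_const (rowMean f₁ V' n ν)) using 1
    ext y
    simp
  · have hlim : Tendsto (fun n : ℕ => C / δ ^ ε *
        (rowStd f₁ V' n / (n : ℝ) ^ (1 / (2 + ε)))⁻¹ ^ (2 + ε)) atTop (𝓝 0) := by
      have h1 := (tendsto_inv_atTop_zero.comp hs).rpow_const (p := 2 + ε) (Or.inr hp.le)
      rw [Real.zero_rpow hp.ne'] at h1
      simpa using h1.const_mul (C / δ ^ ε)
    refine squeeze_zero' (.of_forall fun n => div_nonneg (Finset.sum_nonneg fun ν _ =>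
      integral_nonneg fun _ => sq_nonneg _) (sq_nonneg _)) ?_ hlim
    filter_upwards [hC, hint, hpos, eventually_gt_atTop 0] with n hCn hin hsn hn
    have hn0 : (0 : ℝ) < n := by exact_mod_cast hn
    have hle : ∀ ν ∈ Finset.range n,
        ∫ y in {y | δ * rowStd f₁ V' n < |f₁ (meanDist V' n) y - rowMean f₁ V' n ν|},
          (f₁ (meanDist V' n) y - rowMean f₁ V' n ν) ^ 2 ∂(V' ν) ≤
        C / (δ * rowStd f₁ V' n) ^ ε := fun ν hν => by
      have hν := Finset.mem_range.1 hν
      refine (setIntegral_sq_le_rpow_div hε (mul_pos hδ hsn)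
        ((hin ν hν).sub (integrable_const _)).aestronglyMeasurable (hCn ν hν).1).trans ?_
      gcongr
      exact (hCn ν hν).2
    have hsum := Finset.sum_le_card_nsmul _ _ _ hle
    rw [Finset.card_range, nsmul_eq_mul] at hsum
    refine (div_le_div_of_nonneg_right hsum (sq_nonneg _)).trans_eq ?_
    rw [inv_div, Real.div_rpow (by positivity) hsn.le, ← Real.rpow_mul hn0.le,
      one_div_mul_cancel hp.ne', Real.rpow_one, Real.rpow_add hsn, Real.rpow_two,
      Real.mul_rpow hδ.le hsn.le]
    field_simp

end LyapunovLindeberg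

/-! ### Asymptotic normality of the linear part; negligibility of the remainder -/

section LinearPart

lemma integral_comp_eq_of_ae_eq {Ω α : Type*} [MeasurableSpace Ω] [MeasurableSpace α]
    {μ : Measure Ω} {Z : Ω → α} (hZ : Measurable Z)
    {g G : α → ℝ} (hG : Measurable G) (hgG : g =ᵐ[μ.map Z] G) {φ : ℝ → ℝ} (hφ : Measurable φ) :
    ∫ ω, φ (G (Z ω)) ∂μ = ∫ y, φ (g y) ∂(μ.map Z) := by
  rw [← integral_map (f := fun y => φ (G y)) hZ.aemeasurable
    (hφ.comp hG).aestronglyMeasurable]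
  refine integral_congr_ae ?_
  filter_upwards [hgG] with y hy
  rw [hy]

variable {k : ℕ} {Ω : Type*} [MeasurableSpace Ω] {μ : Measure Ω} [IsProbabilityMeasure μ]
  {V' : ℕ → Measure (Fin k → ℝ)} {X : ℕ → Ω → Fin k → ℝ}
  {f₁ : Measure (Fin k → ℝ) → (Fin k → ℝ) → ℝ}

/-- The linear part of the expansion is asymptotically normal. -/
lemma LindebergCondition.tendsto_measureReal (hX : ∀ ν, Measurable (X ν))
    (hlaw : ∀ ν, μ.map (X ν) = V' ν) (hindep : iIndepFun X μ) (h : LindebergCondition f₁ V')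
    (u : ℝ) :
    Tendsto (fun n => μ.real {ω | (√2 * rowStd f₁ V' n)⁻¹ * ∑ i ∈ Finset.range n,
      (f₁ (meanDist V' n) (X i ω) - rowMean f₁ V' n i) ≤ u}) atTop (𝓝 (gaussPhi u)) := by
  have hprob : ∀ i, IsProbabilityMeasure (V' i) := fun i => by
    rw [← hlaw i]
    exact Measure.isProbabilityMeasure_map (hX i).aemeasurable
  obtain ⟨hmem, hpos, hlin⟩ := h
  -- The hypotheses hold only from some `N` on, whereas Lindeberg's theorem above wants all rows:
  -- the array is shifted by `N`.
  obtain ⟨N, hN⟩ := eventually_atTop.1 (hmem.and hpos)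
  -- `f'{Vₙ, ·}` is only a.e. measurable, with a null set depending on `V' i`; hence a measurable
  -- version for each `n` and `i`, with default 0 outside `L²`.
  have hmeas : ∀ n i, ∃ G : (Fin k → ℝ) → ℝ, Measurable G ∧
      (MemLp (f₁ (meanDist V' n)) 2 (V' i) → f₁ (meanDist V' n) =ᵐ[V' i] G) := fun n i => by
    by_cases hm : MemLp (f₁ (meanDist V' n)) 2 (V' i)
    · exact ⟨hm.aemeasurable.mk _, hm.aemeasurable.measurable_mk, fun _ => hm.aemeasurable.ae_eq_mk⟩
    · exact ⟨0, measurable_const, fun hc => absurd hc hm⟩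
  choose G mG hG using hmeas
  set c : ℕ → ℝ := fun n => (√2 * rowStd f₁ V' n)⁻¹ with hc
  set a : ℕ → ℕ → ℝ := rowMean f₁ V' with ha
  set Y : ℕ → ℕ → Ω → ℝ := fun n i ω => c (n + N) * (G (n + N) i (X i ω) - a (n + N) i) with hY
  have hlt : ∀ {n i}, i ∈ Finset.range (n + N) → MemLp (f₁ (meanDist V' (n + N))) 2 (V' i) :=
    fun {n i} hi => (hN (n + N) (Nat.le_add_left _ _)).1 i (Finset.mem_range.1 hi)
  have hs0 : ∀ n, 0 < rowStd f₁ V' (n + N) := fun n => (hN (n + N) (Nat.le_add_left _ _)).2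
  have hc0 : ∀ n, 0 < c (n + N) := fun n => inv_pos.2 (mul_pos (by positivity) (hs0 n))
  have hc2 : ∀ n, c (n + N) ^ 2 = 1 / 2 / rowStd f₁ V' (n + N) ^ 2 := fun n => by
    rw [hc, inv_pow, mul_pow, Real.sq_sqrt zero_le_two]
    field_simp
  have hG' : ∀ {n i}, i ∈ Finset.range (n + N) →
      f₁ (meanDist V' (n + N)) =ᵐ[μ.map (X i)] G (n + N) i := fun {n i} hi => by
    rw [hlaw]
    exact hG _ _ (hlt hi)
  have transfer : ∀ {n i}, i ∈ Finset.range (n + N) → ∀ φ : ℝ → ℝ, Measurable φ →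
      ∫ ω, φ (G (n + N) i (X i ω)) ∂μ = ∫ y, φ (f₁ (meanDist V' (n + N)) y) ∂(V' i) :=
    fun {n i} hi φ hφ => by
      rw [integral_comp_eq_of_ae_eq (hX i) (mG _ _) (hG' hi) hφ, hlaw]
  have mY : ∀ n i, Measurable (Y n i) := fun n i =>
    (((mG _ _).comp (hX i)).sub_const _).const_mul _
  have hYind : ∀ n, iIndepFun (Y n) μ := fun n =>
    hindep.comp (fun i y => c (n + N) * (G (n + N) i y - a (n + N) i))
      fun i => ((mG _ _).sub_const _).const_mul _
  have h2 : ∀ n, ∀ i ∈ Finset.range (n + N), MemLp (Y n i) 2 μ := fun n i hi => by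
    have h1 : MemLp (G (n + N) i) 2 (μ.map (X i)) := by
      refine (memLp_congr_ae (hG' hi)).1 ?_
      rw [hlaw]
      exact hlt hi
    exact ((h1.comp_of_map (hX i).aemeasurable).sub (memLp_const _)).const_mul _
  have h0 : ∀ n, ∀ i ∈ Finset.range (n + N), ∫ ω, Y n i ω ∂μ = 0 := fun n i hi => by
    rw [hY, transfer hi (fun z => c (n + N) * (z - a (n + N) i)) (by fun_prop),
      integral_const_mul, integral_sub ((hlt hi).integrable (by norm_num)) (integrable_const _)]
    simp [ha, rowMean]
  have hv : ∀ n, ∑ i ∈ Finset.range (n + N), ∫ ω, Y n i ω ^ 2 ∂μ = ((1 / 2 : NNReal) : ℝ) := by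
    intro n
    have : ∀ i ∈ Finset.range (n + N),
        ∫ ω, Y n i ω ^ 2 ∂μ = c (n + N) ^ 2 * rowVar f₁ V' (n + N) i := fun i hi => by
      rw [hY, transfer hi (fun z => (c (n + N) * (z - a (n + N) i)) ^ 2) (by fun_prop), rowVar,
        ← integral_const_mul]
      simp only [mul_pow, ha]
    rw [Finset.sum_congr rfl this, ← Finset.mul_sum, ← rowStd_sq, hc2,
      div_mul_cancel₀ _ (pow_pos (hs0 n) 2).ne']
    simp
  have hL : ∀ δ : ℝ, 0 < δ → Tendsto (fun n => ∑ i ∈ Finset.range (n + N),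
      ∫ ω in {ω | δ < |Y n i ω|}, Y n i ω ^ 2 ∂μ) atTop (𝓝 0) := by
    intro δ hδ
    -- Since `Y` carries the factor `(√2 sₙ)⁻¹`, truncation at `δ` corresponds to `δ √2 sₙ`, and
    -- squaring produces the 1/2.
    have hl := ((hlin (δ * √2) (by positivity)).comp (tendsto_add_atTop_nat N)).const_mul (1 / 2)
    rw [mul_zero] at hl
    refine hl.congr fun n => ?_
    have : ∀ i ∈ Finset.range (n + N), ∫ ω in {ω | δ < |Y n i ω|}, Y n i ω ^ 2 ∂μ =
        c (n + N) ^ 2 * ∫ y in {y | δ * √2 * rowStd f₁ V' (n + N) <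
          |f₁ (meanDist V' (n + N)) y - rowMean f₁ V' (n + N) i|},
          (f₁ (meanDist V' (n + N)) y - rowMean f₁ V' (n + N) i) ^ 2 ∂(V' i) := fun i hi => by
      have hset : ∀ z : ℝ, δ < |c (n + N) * z| ↔ δ * √2 * rowStd f₁ V' (n + N) < |z| := fun z => by
        rw [abs_mul, abs_of_pos (hc0 n), hc, mul_assoc, ← div_eq_inv_mul,
          lt_div_iff₀ (mul_pos (by positivity) (hs0 n))]
      set φ : ℝ → ℝ := {z | δ < |c (n + N) * (z - a (n + N) i)|}.indicator
        fun z => (c (n + N) * (z - a (n + N) i)) ^ 2 with hφ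
      have mφ : Measurable φ := Measurable.indicator (by fun_prop)
        (measurableSet_lt measurable_const (by fun_prop))
      have ms : MeasurableSet {ω | δ < |Y n i ω|} :=
        measurableSet_lt measurable_const (mY n i).abs
      have e1 : ∫ ω in {ω | δ < |Y n i ω|}, Y n i ω ^ 2 ∂μ =
          ∫ ω, φ (G (n + N) i (X i ω)) ∂μ := by
        rw [← integral_indicator ms]
        rfl
      have ns : NullMeasurableSet {y | δ * √2 * rowStd f₁ V' (n + N) <
          |f₁ (meanDist V' (n + N)) y - rowMean f₁ V' (n + N) i|} (V' i) :=
        nullMeasurableSet_lt aemeasurable_const ((hlt hi).aemeasurable.sub_const _).norm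
      rw [e1, transfer hi φ mφ, ← integral_indicator₀ ns, ← integral_const_mul]
      congr 1
      ext y
      by_cases hy : δ * √2 * rowStd f₁ V' (n + N) <
          |f₁ (meanDist V' (n + N)) y - rowMean f₁ V' (n + N) i|
      · rw [hφ, indicator_of_mem (s := {z | δ < |c (n + N) * (z - a (n + N) i)|}) ((hset _).2 hy),
          indicator_of_mem (s := {y | δ * √2 * rowStd f₁ V' (n + N) <
          |f₁ (meanDist V' (n + N)) y - rowMean f₁ V' (n + N) i|}) hy, mul_pow]
      · rw [hφ, indicator_of_notMem (s := {z | δ < |c (n + N) * (z - a (n + N) i)|})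
            (mt (hset _).1 hy),
          indicator_of_notMem (s := {y | δ * √2 * rowStd f₁ V' (n + N) <
          |f₁ (meanDist V' (n + N)) y - rowMean f₁ V' (n + N) i|}) hy, mul_zero]
    rw [Finset.sum_congr rfl this, ← Finset.mul_sum, hc2]
    simp only [Function.comp]
    ring
  have hlim := tendsto_measureReal_sum_le_of_lindeberg mY hYind h2 h0 (v := 1 / 2) (by norm_num)
    hv hL u
  rw [← gaussPhi_eq_gaussianReal] at hlim
  rw [← tendsto_add_atTop_iff_nat N]
  refine hlim.congr fun n => measureReal_congr ?_
  have hae : ∀ᵐ ω ∂μ, ∀ i ∈ Finset.range (n + N),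
      f₁ (meanDist V' (n + N)) (X i ω) = G (n + N) i (X i ω) := by
    rw [Finset.eventually_all]
    exact fun i hi => ae_of_ae_map (hX i).aemeasurable (hG' hi)
  filter_upwards [hae] with ω hω
  refine propext ?_
  change ∑ i ∈ Finset.range (n + N), Y n i ω ≤ u ↔ _ ≤ u
  rw [← Finset.mul_sum, Finset.sum_congr rfl fun i hi => by rw [← hω i hi]]

/-- The quadratic part of the expansion is negligible. -/
lemma tendsto_measureReal_le_abs_remainder (hX : ∀ ν, Measurable (X ν))
    (hlaw : ∀ ν, μ.map (X ν) = V' ν) (hindep : iIndepFun X μ)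
    (hcont : ∀ ν, Continuous (distFun (V' ν)))
    {J : Set (Measure (Fin k → ℝ))} (hJ : IsConvexDistSet J)
    (hJV : ∀ᶠ n in atTop, meanDist V' n ∈ J)
    (hJS : ∀ᶠ n in atTop, ∀ᵐ ω ∂μ, empiricalDist (fun i => X i ω) n ∈ J)
    {f : Measure (Fin k → ℝ) → ℝ} {f₂ : Measure (Fin k → ℝ) → (Fin k → ℝ) → (Fin k → ℝ) → ℝ}
    (hf : IsTwiceVonMisesDiffOn J f f₁ f₂) {ψ : (Fin k → ℝ) → ℝ} (hψ : Measurable ψ)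
    (hψ0 : ∀ x, 0 ≤ ψ x)
    (hdom : ∀ᶠ n in atTop, ∀ᵐ ω ∂μ, ∀ V ∈ J,
      ENNReal.ofReal |integralDiff₂ (f₂ V) (meanDist V' n) (empiricalDist (fun i => X i ω) n)|
        ≤ ∫⁻ x, ENNReal.ofReal (ψ x * (distFun (meanDist V' n) x
            - distFun (empiricalDist (fun i => X i ω) n) x) ^ 2))
    (hlim : Tendsto (fun n => (∫⁻ x, ENNReal.ofReal (ψ x * (distFun (meanDist V' n) x
        * (1 - distFun (meanDist V' n) x)))) / ENNReal.ofReal (rowStd f₁ V' n)) atTop (𝓝 0))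
    (hpos : ∀ᶠ n in atTop, 0 < rowStd f₁ V' n) {H : ℕ → ℝ}
    (hH : ∀ᶠ n in atTop, H n = n * (√2 * rowStd f₁ V' n)⁻¹) {η : ℝ} (hη : 0 < η) :
    Tendsto (fun n => μ.real {ω | η ≤ |H n * (f (empiricalDist (fun i => X i ω) n)
        - f (meanDist V' n)) - (√2 * rowStd f₁ V' n)⁻¹ * ∑ i ∈ Finset.range n,
      (f₁ (meanDist V' n) (X i ω) - rowMean f₁ V' n i)|}) atTop (𝓝 0) := by
  set I : ℕ → ℝ≥0∞ := fun n => ∫⁻ x, ENNReal.ofReal (ψ x * (distFun (meanDist V' n) x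
    * (1 - distFun (meanDist V' n) x))) with hI
  set Q : ℕ → Ω → ℝ≥0∞ := fun n ω => ∫⁻ x, ENNReal.ofReal (ψ x * (distFun (meanDist V' n) x
    - distFun (empiricalDist (fun i => X i ω) n) x) ^ 2) with hQ
  -- The constant is `(Hₙ / 2) · n⁻¹ = (2√2 sₙ)⁻¹`: half from Taylor's inequality, `n⁻¹` from the
  -- mean square of `Tₙ`.
  have hbound : Tendsto (fun n => ENNReal.ofReal (2 * √2)⁻¹ *
      (I n / ENNReal.ofReal (rowStd f₁ V' n)) / ENNReal.ofReal η) atTop (𝓝 0) := by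
    have h1 := ENNReal.Tendsto.const_mul hlim (a := ENNReal.ofReal (2 * √2)⁻¹)
      (Or.inr ENNReal.ofReal_ne_top)
    have h2 := ENNReal.Tendsto.div_const h1 (b := ENNReal.ofReal η)
      (Or.inr (by simpa using hη))
    simpa using h2
  have hmain : Tendsto (fun n => μ {ω | η ≤ |H n * (f (empiricalDist (fun i => X i ω) n)
        - f (meanDist V' n)) - (√2 * rowStd f₁ V' n)⁻¹ * ∑ i ∈ Finset.range n,
      (f₁ (meanDist V' n) (X i ω) - rowMean f₁ V' n i)|}) atTop (𝓝 0) := by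
    refine tendsto_of_tendsto_of_tendsto_of_le_of_le' tendsto_const_nhds hbound
      (.of_forall fun _ => zero_le) ?_
    filter_upwards [hJV, hJS, hdom, hpos, hH, eventually_ne_atTop 0] with n hVn hSn hdn hsn hHn hn
    have hn0 : (0 : ℝ) < n := by positivity
    have hHpos : 0 < H n := by rw [hHn]; positivity
    have hQm : Measurable (Q n) := measurable_lintegral_sq_distFun_sub hX hlaw hcont hψ n
    have hle : ∀ᵐ ω ∂μ, ENNReal.ofReal |H n * (f (empiricalDist (fun i => X i ω) n)
        - f (meanDist V' n)) - (√2 * rowStd f₁ V' n)⁻¹ * ∑ i ∈ Finset.range n,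
        (f₁ (meanDist V' n) (X i ω) - rowMean f₁ V' n i)| ≤ ENNReal.ofReal (H n / 2) * Q n ω := by
      filter_upwards [hSn, hdn] with ω hSω hdω
      -- Where `∫ ψ Tₙ²` is infinite the bound is trivial.
      by_cases htop : Q n ω = ∞
      · rw [htop, ENNReal.mul_top (by simpa using hHpos)]
        exact le_top
      have hT := hf.abs_sub_sub_integralDiff_le hJ hVn hSω (M := (Q n ω).toReal) fun W hW =>
        (ENNReal.ofReal_le_iff_le_toReal htop).1 (hdω W hW)
      rw [integralDiff_empiricalDist_meanDist ((hf _ hVn).1 _ hVn).1] at hT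
      have e : (√2 * rowStd f₁ V' n)⁻¹ = H n * (n : ℝ)⁻¹ := by
        rw [hHn]
        field_simp
      rw [e, mul_assoc, ← mul_sub, abs_mul, abs_of_pos hHpos, ← ENNReal.ofReal_toReal htop,
        ← ENNReal.ofReal_mul (by positivity)]
      refine ENNReal.ofReal_le_ofReal ?_
      calc _ ≤ H n * ((Q n ω).toReal / 2) := mul_le_mul_of_nonneg_left hT hHpos.le
        _ = _ := by ring
    calc μ {ω | η ≤ |H n * (f (empiricalDist (fun i => X i ω) n)
        - f (meanDist V' n)) - (√2 * rowStd f₁ V' n)⁻¹ * ∑ i ∈ Finset.range n,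
        (f₁ (meanDist V' n) (X i ω) - rowMean f₁ V' n i)|}
        -- `f` of the empirical distribution need not be measurable in `ω`; Markov's inequality is
        -- applied to the measurable majorant.
        ≤ μ {ω | ENNReal.ofReal η ≤ ENNReal.ofReal (H n / 2) * Q n ω} := by
          refine measure_mono_ae ?_
          filter_upwards [hle] with ω hω hωη
          exact (ENNReal.ofReal_le_ofReal hωη).trans hω
      _ ≤ (∫⁻ ω, ENNReal.ofReal (H n / 2) * Q n ω ∂μ) / ENNReal.ofReal η :=
          meas_ge_le_lintegral_div (hQm.const_mul _).aemeasurable (by simpa using hη)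
            ENNReal.ofReal_ne_top
      _ ≤ ENNReal.ofReal (2 * √2)⁻¹ * (I n / ENNReal.ofReal (rowStd f₁ V' n)) /
            ENNReal.ofReal η := by
          gcongr
          rw [lintegral_const_mul _ hQm]
          have e1 : ENNReal.ofReal (H n / 2) * (n : ℝ≥0∞)⁻¹ =
              ENNReal.ofReal (2 * √2)⁻¹ * (ENNReal.ofReal (rowStd f₁ V' n))⁻¹ := by
            rw [← ENNReal.ofReal_natCast, ← ENNReal.ofReal_inv_of_pos hn0,
              ← ENNReal.ofReal_inv_of_pos hsn, ← ENNReal.ofReal_mul (by positivity),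
              ← ENNReal.ofReal_mul (by positivity), hHn]
            congr 1
            field_simp
          calc ENNReal.ofReal (H n / 2) * ∫⁻ ω, Q n ω ∂μ
              ≤ ENNReal.ofReal (H n / 2) * ((n : ℝ≥0∞)⁻¹ * I n) := by
                gcongr
                exact lintegral_lintegral_sq_distFun_sub_le hX hlaw hindep hcont hψ hψ0 hn
            _ = _ := by rw [← mul_assoc, e1, mul_assoc, div_eq_mul_inv, mul_comm (I n)]
  exact (ENNReal.tendsto_toReal ENNReal.zero_ne_top).comp hmain

end LinearPart

/-! ### The limit theorem -/

theorem mainTheorem1 {k : ℕ} {Ω : Type*} [MeasurableSpace Ω] (μ : Measure Ω)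
    [IsProbabilityMeasure μ]
    -- independent trials `X ν` with continuous distributions `V' ν`
    (V' : ℕ → Measure (Fin k → ℝ)) (X : ℕ → Ω → Fin k → ℝ)
    (hX : ∀ ν, Measurable (X ν)) (hlaw : ∀ ν, μ.map (X ν) = V' ν) (hindep : iIndepFun X μ)
    (hcont : ∀ ν, Continuous (distFun (V' ν)))
    -- the statistical functional, twice differentiable on the convex set `J`
    (J : Set (Measure (Fin k → ℝ))) (hJ : IsConvexDistSet J)
    (hJV : ∀ᶠ n in atTop, meanDist V' n ∈ J)
    (hJS : ∀ᶠ n in atTop, ∀ᵐ ω ∂μ, empiricalDist (fun i => X i ω) n ∈ J)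
    (f : Measure (Fin k → ℝ) → ℝ) (f₁ : Measure (Fin k → ℝ) → (Fin k → ℝ) → ℝ)
    (f₂ : Measure (Fin k → ℝ) → (Fin k → ℝ) → (Fin k → ℝ) → ℝ)
    (hf : IsTwiceVonMisesDiffOn J f f₁ f₂)
    -- the first derivative satisfies conditions of the classical limit theorem
    (hclass : LindebergCondition f₁ V' ∨ ∃ ε : ℝ, 0 < ε ∧ ε < 1 ∧ LyapunovCondition f₁ V' ε)
    -- domination of the second derivative term
    (hsecond : ∃ ψ : (Fin k → ℝ) → ℝ, Measurable ψ ∧ (∀ x, 0 ≤ ψ x) ∧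
      (∀ᶠ n in atTop, ∀ᵐ ω ∂μ, ∀ V ∈ J,
        ENNReal.ofReal |integralDiff₂ (f₂ V) (meanDist V' n) (empiricalDist (fun i => X i ω) n)|
          ≤ ∫⁻ x, ENNReal.ofReal (ψ x * (distFun (meanDist V' n) x
              - distFun (empiricalDist (fun i => X i ω) n) x) ^ 2)) ∧
      Tendsto (fun n => (∫⁻ x, ENNReal.ofReal (ψ x * (distFun (meanDist V' n) x
          * (1 - distFun (meanDist V' n) x)))) / ENNReal.ofReal (rowStd f₁ V' n))
        atTop (𝓝 0))
    -- the normalizing factors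
    (H : ℕ → ℝ)
    (hH : ∀ᶠ n in atTop, 0 < H n ∧ 1 / (2 * H n ^ 2) = rowStd f₁ V' n ^ 2 / (n : ℝ) ^ 2) :
    (∀ᶠ n in atTop, rowStd f₁ V' n ^ 2 / (n : ℝ) ^ 2 =
      1 / (n : ℝ) ^ 2 * ∑ ν ∈ Finset.range n,
        (∫ y, f₁ (meanDist V' n) y ^ 2 ∂(V' ν) - (∫ y, f₁ (meanDist V' n) y ∂(V' ν)) ^ 2)) ∧
    TendstoUniformly
      (fun n u => μ.real {ω | H n * (f (empiricalDist (fun i => X i ω) n)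
        - f (meanDist V' n)) ≤ u})
      gaussPhi atTop := by
  have hprob : ∀ i, IsProbabilityMeasure (V' i) := fun i => by
    rw [← hlaw i]
    exact Measure.isProbabilityMeasure_map (hX i).aemeasurable
  have hint : ∀ᶠ n in atTop, ∀ ν < n, Integrable (f₁ (meanDist V' n)) (V' ν) := by
    filter_upwards [hJV] with n hn ν hν
    exact integrable_of_integrable_meanDist ((hf _ hn).1 _ hn).1 hν
  have hlind : LindebergCondition f₁ V' := by
    rcases hclass with h | ⟨ε, hε, -, h⟩
    · exact h
    · exact h.lindebergCondition hε hint
  obtain ⟨ψ, hψ, hψ0, hdom, hlim⟩ := hsecond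
  refine ⟨?_, ?_⟩
  · filter_upwards [hlind.1] with n hn
    rw [rowStd_sq, div_eq_inv_mul, one_div]
    congr 1
    exact Finset.sum_congr rfl fun ν hν => rowVar_eq (hn ν (Finset.mem_range.1 hν))
  have hH' : ∀ᶠ n in atTop, H n = n * (√2 * rowStd f₁ V' n)⁻¹ := by
    filter_upwards [hH, hlind.2.1, eventually_ne_atTop 0] with n hHn hsn hn
    obtain ⟨hpos, heq⟩ := hHn
    have hn0 : (0 : ℝ) < n := by positivity
    -- The defining relation fixes `Hₙ²`; positivity selects the root `n / (√2 sₙ)`.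
    refine (sq_eq_sq₀ hpos.le (by positivity)).1 ?_
    rw [mul_pow, inv_pow, mul_pow, Real.sq_sqrt zero_le_two]
    field_simp at heq ⊢
    linarith
  refine tendstoUniformly_of_monotone_of_continuous
    (fun n u v huv => measureReal_mono fun ω hω => le_trans hω huv)
    (fun _ _ => measureReal_nonneg) (fun _ _ => measureReal_le_one)
    (gaussPhi_eq_cdf ▸ monotone_cdf _) continuous_gaussPhi
    (gaussPhi_eq_cdf ▸ tendsto_cdf_atBot _) (gaussPhi_eq_cdf ▸ tendsto_cdf_atTop _)
    (tendsto_measureReal_le_of_sub continuous_gaussPhi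
      (hlind.tendsto_measureReal hX hlaw hindep)
      fun η hη => tendsto_measureReal_le_abs_remainder hX hlaw hindep hcont hJ hJV hJS hf hψ hψ0
        hdom hlim hlind.2.1 hH' hη)
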